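/- Let $\mathbb K\in\{\mathbb R,\mathbb C\}$, let $\lambda$ denote Lebesgue measure on $(0,\infty)$, and let $T$ be the $C_0$-semigroup on $L_2(0,\infty)=L_2((0,\infty);\mathbb K)$ generated by the Dirichlet Laplacian $\Delta_{\mathrm D}$, where $\operatorname{dom}(\Delta_{\mathrm D})=\{u\in H^1_0(0,\infty) : \Delta u\in L_2(0,\infty)\}$ and $\Delta_{\mathrm D}u=\Delta u$ (distributional Laplacian). For a bounded measurable $W\colon(0,\infty)\to\mathbb R$ let $T_W$ be the $C_0$-semigroup generated by $\Delta_{\mathrm D}-W$. A measurable $V\colon(0,\infty)\to\mathbb R$ is called $T$-admissible if for each of the two sequences of bounded potentials $V^+\wedge n$ and $(-V^-)\vee(-n)$, $n\in\mathbb N$, the associated semigroups converge strongly on $L_2(0,\infty)$ for every $t\ge0$, and the limit is a $C_0$-semigroup. The perturbed semigroup $T_V$ is the $C_0$-semigroup given by the strong limits $T_V(t)=\lim_{n\to\infty}T_{(V\wedge n)\vee(-n)}(t)$, $t\ge0$. Let $V\colon(0,\infty)\to\mathbb R$ be measurable, and suppose that there is $\alpha\in(0,1)$ with $$\int_0^\infty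 x\,|V(x)|\,dx\le\alpha .$$ Then $V$ is $T$-admissible, the $C_0$-semigroup $T_V$ exists, and with $m(x):=x$ one has for all $t\ge 0$ $$\|m^{-1}T_V(t)m\|_{L_1(m^2\lambda)\to L_1(m^2\lambda)}\le\frac1{1-\alpha},$$ where the left-hand side denotes $$\sup\bigl\{\|m^{-1}T_V(t)(mf)\|_{L_1(m^2\lambda)} : f\in L_1(m^2\lambda),\ \|f\|_{L_1(m^2\lambda)}\le1,\ mf\in L_2(0,\infty)\bigr\}.$$ -/

import Mathlib

open MeasureTheory Filter Topology Set
open scoped ENNReal NNReal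

noncomputable section

/-! ### Strongly continuous semigroups and their generators -/

/-- `T` is a `C₀`-semigroup on `E`. -/
structure IsC0Semigroup {𝕜 E : Type*} [RCLike 𝕜] [NormedAddCommGroup E] [NormedSpace 𝕜 E]
    (T : ℝ≥0 → E →L[𝕜] E) : Prop where
  map_zero : T 0 = ContinuousLinearMap.id 𝕜 E
  map_add : ∀ s t : ℝ≥0, T (s + t) = (T s).comp (T t)
  tendsto_zero : ∀ f : E, Tendsto (fun t : ℝ≥0 => T t f) (𝓝 0) (𝓝 f)

/-- The generator of `T`, as a graph: `(u, w)` belongs to it iff `u` is in the domain of the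
generator `A` and `A u = w`, i.e. iff `t⁻¹ (T(t)u - u) → w` as `t → 0`, `t > 0`. -/
def generatorGraph {𝕜 E : Type*} [RCLike 𝕜] [NormedAddCommGroup E] [NormedSpace 𝕜 E]
    (T : ℝ≥0 → E →L[𝕜] E) : Set (E × E) :=
  {p | Tendsto (fun t : ℝ≥0 => (((t : ℝ) : 𝕜)⁻¹) • (T t p.1 - p.1)) (𝓝[>] 0) (𝓝 p.2)}

/-! ### Perturbation by potentials and admissibility -/

/-- For a bounded potential `W`, the family `S` is the `C₀`-semigroup `T_W`, i.e. the
`C₀`-semigroup generated by `A - W`, where `A` is the generator of `T` and `W` acts by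
multiplication. (For bounded `W` the domain of `A - W` is the domain of `A`.) -/
def IsBoundedPerturbation {𝕜 Ω : Type*} [RCLike 𝕜] [MeasurableSpace Ω] {μ : Measure Ω}
    {p : ℝ≥0∞} [Fact (1 ≤ p)]
    (T : ℝ≥0 → Lp 𝕜 p μ →L[𝕜] Lp 𝕜 p μ) (W : Ω → ℝ)
    (S : ℝ≥0 → Lp 𝕜 p μ →L[𝕜] Lp 𝕜 p μ) : Prop :=
  IsC0Semigroup S ∧
    generatorGraph S = {q | ∃ w : Lp 𝕜 p μ, (q.1, w) ∈ generatorGraph T ∧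
      ∀ᵐ x ∂μ, q.2 x = w x - (W x : 𝕜) * q.1 x}

/-- `S(t)` is the strong limit of `T_{W n}(t)` as `n → ∞`, for every `t ≥ 0`, where the
potentials `W n` are bounded. -/
def IsStrongLimitOfPerturbations {𝕜 Ω : Type*} [RCLike 𝕜] [MeasurableSpace Ω] {μ : Measure Ω}
    {p : ℝ≥0∞} [Fact (1 ≤ p)]
    (T : ℝ≥0 → Lp 𝕜 p μ →L[𝕜] Lp 𝕜 p μ) (W : ℕ → Ω → ℝ)
    (S : ℝ≥0 → Lp 𝕜 p μ →L[𝕜] Lp 𝕜 p μ) : Prop :=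
  ∃ R : ℕ → ℝ≥0 → Lp 𝕜 p μ →L[𝕜] Lp 𝕜 p μ,
    (∀ n, IsBoundedPerturbation T (W n) (R n)) ∧
      ∀ (t : ℝ≥0) (f : Lp 𝕜 p μ), Tendsto (fun n => R n t f) atTop (𝓝 (S t f))

/-- `V` is `T`-admissible: the strong limits of `T_{V⁺ ∧ n}(t)` and of `T_{(-V⁻) ∨ (-n)}(t)`
exist for all `t ≥ 0`, and both of them define `C₀`-semigroups. -/
def IsAdmissible {𝕜 Ω : Type*} [RCLike 𝕜] [MeasurableSpace Ω] {μ : Measure Ω}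
    {p : ℝ≥0∞} [Fact (1 ≤ p)]
    (T : ℝ≥0 → Lp 𝕜 p μ →L[𝕜] Lp 𝕜 p μ) (V : Ω → ℝ) : Prop :=
  (∃ S, IsC0Semigroup S ∧
      IsStrongLimitOfPerturbations T (fun n x => min (max (V x) 0) (n : ℝ)) S) ∧
    ∃ S, IsC0Semigroup S ∧
      IsStrongLimitOfPerturbations T (fun n x => max (min (V x) 0) (-(n : ℝ))) S

/-- The family `S` is the `C₀`-semigroup `T_V`, i.e. the strong limit of the semigroups
`T_{(V ∧ n) ∨ (-n)}`. -/
def IsPerturbedSemigroup {𝕜 Ω : Type*} [RCLike 𝕜] [MeasurableSpace Ω] {μ : Measure Ω}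
    {p : ℝ≥0∞} [Fact (1 ≤ p)]
    (T : ℝ≥0 → Lp 𝕜 p μ →L[𝕜] Lp 𝕜 p μ) (V : Ω → ℝ)
    (S : ℝ≥0 → Lp 𝕜 p μ →L[𝕜] Lp 𝕜 p μ) : Prop :=
  IsC0Semigroup S ∧
    IsStrongLimitOfPerturbations T (fun n x => max (min (V x) (n : ℝ)) (-(n : ℝ))) S

/-! ### Weighted operator norms -/

/-- The (possibly infinite) norm `‖ρ₁⁻¹ A ρ₁‖` from `L_q(ρ₂ μ)` to `L_r(ρ₂ μ)` of an operator `A`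
on `L_p(μ)`: the supremum of `‖ρ₁⁻¹ A (ρ₁ f)‖_{L_r(ρ₂ μ)}` over all `f ∈ L_q(ρ₂ μ)` such that
`‖f‖_{L_q(ρ₂ μ)} ≤ 1` and `ρ₁ f ∈ L_p(μ)`. -/
def weightedOpNorm {𝕜 Ω : Type*} [RCLike 𝕜] [MeasurableSpace Ω] {μ : Measure Ω}
    {p : ℝ≥0∞} [Fact (1 ≤ p)] (A : Lp 𝕜 p μ →L[𝕜] Lp 𝕜 p μ)
    (ρ₁ ρ₂ : Ω → ℝ) (q r : ℝ≥0∞) : ℝ≥0∞ :=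
  ⨆ (f : Ω → 𝕜) (_ : MemLp f q (μ.withDensity fun x => ENNReal.ofReal (ρ₂ x)))
    (_ : eLpNorm f q (μ.withDensity fun x => ENNReal.ofReal (ρ₂ x)) ≤ 1)
    (h : MemLp (fun x => (ρ₁ x : 𝕜) * f x) p μ),
    eLpNorm (fun x => (ρ₁ x : 𝕜)⁻¹ * A (h.toLp _) x) r
      (μ.withDensity fun x => ENNReal.ofReal (ρ₂ x))

/-! ### The Dirichlet Laplacian on the half-line -/

/-- Lebesgue measure on `(0, ∞)`. -/
abbrev halfLine : Measure ℝ := volume.restrict (Ioi 0)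

/-- `L₂(0, ∞)` with values in `𝕜`. -/
abbrev HalfLineL2 (𝕜 : Type*) [RCLike 𝕜] : Type _ := Lp 𝕜 2 halfLine

/-- `C_c^∞(0, ∞)`; here `⊤ : ℕ∞` stands for infinitely differentiable. -/
abbrev HalfLineTest (𝕜 : Type*) [RCLike 𝕜] : Type _ :=
  TestFunction (⟨Ioi 0, isOpen_Ioi⟩ : TopologicalSpace.Opens ℝ) 𝕜 ⊤

/-- `u ∈ H¹₀(0, ∞)`, the closure of `C_c^∞(0, ∞)` in `H¹(0, ∞)`: there is `v` (the weak derivative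
of `u`) such that `(u, v)` is a limit in `L₂ × L₂` of pairs `(φ, φ')` with test functions `φ`. -/
def MemH10 {𝕜 : Type*} [RCLike 𝕜] (u : HalfLineL2 𝕜) : Prop :=
  ∃ v : HalfLineL2 𝕜, (u, v) ∈ closure {q : HalfLineL2 𝕜 × HalfLineL2 𝕜 |
    ∃ φ : HalfLineTest 𝕜, q.1 =ᵐ[halfLine] φ ∧ q.2 =ᵐ[halfLine] deriv φ}

/-- `Δ u = w` on `(0, ∞)` in the sense of distributions. -/
def HasWeakLaplacian {𝕜 : Type*} [RCLike 𝕜] (u w : HalfLineL2 𝕜) : Prop :=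
  ∀ φ : HalfLineTest 𝕜,
    ∫ x in Ioi (0 : ℝ), u x * deriv (deriv φ) x = ∫ x in Ioi (0 : ℝ), w x * φ x

/-- The graph of the Dirichlet Laplacian on `(0, ∞)`, whose domain consists of all `u ∈ H¹₀(0, ∞)`
with `Δ u ∈ L₂(0, ∞)`. -/
def dirichletLaplacianGraph (𝕜 : Type*) [RCLike 𝕜] : Set (HalfLineL2 𝕜 × HalfLineL2 𝕜) :=
  {q | MemH10 q.1 ∧ HasWeakLaplacian q.1 q.2}

end

noncomputable section

/-! ### Strongly continuous semigroups -/

section Semigroup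

open scoped BoundedContinuousFunction

variable {𝕜 E : Type*} [RCLike 𝕜] [NormedAddCommGroup E] [NormedSpace 𝕜 E]

/-! Two a priori estimates for bounded potentials carry the theorem.

Convergence. For `u ∈ H¹₀` one has `|u(x)| ≤ √x ‖u'‖`, so `|∫ W u v| ≤ (∫ x|W|) ‖u'‖ ‖v'‖`
(`abs_inner_mulOperator_le`). If `∫ x|W| ≤ α < 1`, the form of `-Δ + W` therefore dominates `(1-α)
‖u'‖²`. For two such potentials, differentiating `‖R₁(t)f - R₂(t)f‖² + c ‖R₂(t)f‖²` with a suitable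
`c` and completing a square gives `‖R₁(t) - R₂(t)‖ ≤ ∫ x|W₁ - W₂| / (2(1-α))`
(`norm_perturbation_sub_le`). By dominated convergence the semigroups of the truncations are Cauchy
in operator norm, uniformly in `t`, and the limit is a `C₀`-semigroup.

Weighted bound. With `g = m f` the claim reads `∫ x |T_V(t)g| ≤ (1-α)⁻¹ ∫ x |g|`. The weight `x` is
replaced by a bounded `ω` with `ω(0) = 0`, `-ω'' ≥ |W| ω` and `x(L-x)/L ≤ ω ≤ x/(1-α)`
(`exists_weight`). By Kato's inequality `∫ ω |R(t)g|` is formally nonincreasing, and comparing `ω`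
with `x` at both ends produces the factor `1/(1-α)`. Rigorously, `|z|` is regularised to `√(|z|² +
ε²) - ε`, a convex functional on `L₂` with continuous gradient. This costs an error `O(ε t)`, which
disappears as `ε → 0`, `L → ∞` by Fatou. A further use of Fatou passes from the truncations to `V`.

All differential inequalities are shown on the domain of the generator, where orbits have right
derivatives, and extended by density. -/

theorem mem_generatorGraph_iff [NormedSpace ℝ E] [IsScalarTower ℝ 𝕜 E]
    {T : ℝ≥0 → E →L[𝕜] E} {u w : E} :
    (u, w) ∈ generatorGraph T ↔
      Tendsto (fun t : ℝ≥0 => (t : ℝ)⁻¹ • (T t u - u)) (𝓝[>] 0) (𝓝 w) := by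
  have h : ∀ (t : ℝ≥0) (x : E), (((t : ℝ) : 𝕜)⁻¹) • x = (t : ℝ)⁻¹ • x := fun t x => by
    rw [← RCLike.ofReal_inv, ← RCLike.real_smul_eq_coe_smul]
  simp only [generatorGraph, mem_ofPred_eq, h]

namespace IsC0Semigroup

variable {T : ℝ≥0 → E →L[𝕜] E}

theorem apply_add (hT : IsC0Semigroup T) (s t : ℝ≥0) (f : E) : T (s + t) f = T s (T t f) := by
  rw [hT.map_add]; rfl

theorem apply_zero (hT : IsC0Semigroup T) (f : E) : T 0 f = f := by
  rw [hT.map_zero]; rfl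

/-- Otherwise some `t n → 0` has `‖T (t n)‖` unbounded, although `T (t n) f` converges for every
`f`; this contradicts Banach–Steinhaus. -/
theorem exists_bound_near_zero [CompleteSpace E] (hT : IsC0Semigroup T) :
    ∃ δ : ℝ≥0, 0 < δ ∧ ∃ M : ℝ, 0 ≤ M ∧ ∀ t ≤ δ, ‖T t‖ ≤ M := by
  by_contra! H
  have h1 : ∀ n : ℕ, ∃ t : ℝ≥0, t ≤ 1 / ((n : ℝ≥0) + 1) ∧ (n : ℝ) < ‖T t‖ := fun n =>
    H _ (by positivity) n (Nat.cast_nonneg n)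
  choose t ht hn using h1
  have ht0 : Tendsto t atTop (𝓝 0) := by
    refine tendsto_of_tendsto_of_tendsto_of_le_of_le tendsto_const_nhds
      tendsto_one_div_add_atTop_nhds_zero_nat (fun n => zero_le) ht
  have hb : ∀ f : E, ∃ C, ∀ n, ‖T (t n) f‖ ≤ C := fun f => by
    obtain ⟨C, hC⟩ := ((hT.tendsto_zero f).comp ht0).norm.bddAbove_range
    exact ⟨C, fun n => hC ⟨n, rfl⟩⟩
  obtain ⟨C, hC⟩ := banach_steinhaus hb
  obtain ⟨n, hn'⟩ := exists_nat_gt C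
  exact absurd (hC n) (not_le.2 (hn'.trans (hn n)))

/-- For `p ≤ q`, `T(q)f - T(p)f = T(p)(T(q-p)f - f)`. Only the smaller time needs a norm bound, and
near `t` it lies in `[t-δ, t]`, where the bound near zero transfers by the semigroup law. -/
theorem continuous_orbit [CompleteSpace E] (hT : IsC0Semigroup T) (f : E) :
    Continuous fun t => T t f := by
  obtain ⟨δ, hδ, M, hM, hb⟩ := hT.exists_bound_near_zero
  rw [continuous_iff_continuousAt]
  intro t
  set a := t - δ
  have hloc : ∀ s, a ≤ s → s ≤ t → ‖T s‖ ≤ M * ‖T a‖ := by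
    intro s has hst
    have hs : s = (s - a) + a := (tsub_add_cancel_of_le has).symm
    rw [hs, hT.map_add]
    refine (ContinuousLinearMap.opNorm_comp_le _ _).trans ?_
    gcongr
    apply hb
    rw [tsub_le_iff_right]
    exact hst.trans le_add_tsub
  have hd : ∀ s, a ≤ s → ‖T s f - T t f‖ ≤ M * ‖T a‖ * ‖T (max s t - min s t) f - f‖ := by
    intro s has
    have key : ∀ p q, a ≤ p → p ≤ t → p ≤ q → ‖T q f - T p f‖ ≤ M * ‖T a‖ * ‖T (q - p) f - f‖ := by
      intro p q hap hpt hpq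
      have : T q f - T p f = T p (T (q - p) f - f) := by
        rw [map_sub, ← hT.apply_add, add_tsub_cancel_of_le hpq]
      rw [this]
      exact (T p).le_of_opNorm_le (hloc p hap hpt) _
    rcases le_total s t with h | h
    · rw [max_eq_right h, min_eq_left h, norm_sub_rev]
      exact key s t has h h
    · rw [max_eq_left h, min_eq_right h]
      exact key t s tsub_le_self le_rfl h
  have h0 : Tendsto (fun s : ℝ≥0 => max s t - min s t) (𝓝 t) (𝓝 0) := by
    have : Continuous fun s : ℝ≥0 => max s t - min s t := by fun_prop
    simpa using this.tendsto t
  have h1 : Tendsto (fun s => M * ‖T a‖ * ‖T (max s t - min s t) f - f‖) (𝓝 t) (𝓝 0) := by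
    have := (((hT.tendsto_zero f).comp h0).sub_const f).norm.const_mul (M * ‖T a‖)
    simpa using this
  have ha : ∀ᶠ s in 𝓝 t, a ≤ s := by
    rcases eq_or_lt_of_le (zero_le : 0 ≤ t) with h | h
    · exact Eventually.of_forall fun s => by simp [a, ← h]
    · exact (lt_mem_nhds (tsub_lt_self h hδ)).mono fun s hs => hs.le
  exact tendsto_iff_norm_sub_tendsto_zero.2
    (squeeze_zero' (Eventually.of_forall fun s => norm_nonneg _) (ha.mono hd) h1)

/-- Orbits starting in the domain stay there and are right differentiable at every time; the later
estimates need no left derivative. -/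
theorem mem_generatorGraph_apply [NormedSpace ℝ E] [IsScalarTower ℝ 𝕜 E] (hT : IsC0Semigroup T)
    {u w : E} (h : (u, w) ∈ generatorGraph T) (t : ℝ≥0) :
    (T t u, T t w) ∈ generatorGraph T ∧
      Tendsto (fun s : ℝ≥0 => (s : ℝ)⁻¹ • (T (t + s) u - T t u)) (𝓝[>] 0) (𝓝 (T t w)) := by
  have key : Tendsto (fun s : ℝ≥0 => (s : ℝ)⁻¹ • (T (t + s) u - T t u)) (𝓝[>] 0)
      (𝓝 (T t w)) := by
    refine (((T t).continuous.tendsto w).comp (mem_generatorGraph_iff.1 h)).congr fun s => ?_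
    have : (s : ℝ)⁻¹ • (T s u - u) = (((s : ℝ)⁻¹ : ℝ) : 𝕜) • (T s u - u) :=
      RCLike.real_smul_eq_coe_smul _ _
    rw [Function.comp_apply, this, map_smul, ← RCLike.real_smul_eq_coe_smul, map_sub, hT.apply_add]
  refine ⟨mem_generatorGraph_iff.2 (key.congr fun s => ?_), key⟩
  rw [add_comm, hT.apply_add]

/-- The domain of the generator of a `C₀`-semigroup is dense. -/
theorem dense_domain [NormedSpace ℝ E] [IsScalarTower ℝ 𝕜 E] [CompleteSpace E]
    (hT : IsC0Semigroup T) : Dense {u : E | ∃ w, (u, w) ∈ generatorGraph T} := by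
  intro f
  have hc : Continuous fun s : ℝ => T s.toNNReal f :=
    (hT.continuous_orbit f).comp continuous_real_toNNReal
  -- The means `h⁻¹ X h` converge to `f` and lie in the domain.
  set X : ℝ≥0 → E := fun h => ∫ s in (0 : ℝ)..h, T s.toNNReal f with hX
  have hadd : ∀ r h, X (r + h) = X r + T r (X h) := by
    intro r h
    have h1 : T r (X h) = ∫ s in (0 : ℝ)..h, T (s + r).toNNReal f := by
      rw [hX, ← ContinuousLinearMap.intervalIntegral_comp_comm _ (hc.intervalIntegrable _ _)]
      refine intervalIntegral.integral_congr fun s hs => ?_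
      rw [uIcc_of_le h.coe_nonneg] at hs
      rw [Real.toNNReal_add hs.1 r.coe_nonneg, Real.toNNReal_coe, add_comm, hT.apply_add]
    rw [h1, intervalIntegral.integral_comp_add_right (fun s : ℝ => T s.toNNReal f), zero_add,
      hX]
    simp only [NNReal.coe_add]
    rw [add_comm (h : ℝ), intervalIntegral.integral_add_adjacent_intervals
      (hc.intervalIntegrable _ _) (hc.intervalIntegrable _ _)]
  have hlim : Tendsto (fun r : ℝ≥0 => (r : ℝ)⁻¹ • X r) (𝓝[>] 0) (𝓝 f) := by
    have hd : HasDerivAt (fun x => ∫ s in (0 : ℝ)..x, T s.toNNReal f) (T (0 : ℝ).toNNReal f) 0 :=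
      intervalIntegral.integral_hasDerivAt_right (hc.intervalIntegrable _ _)
        (hc.stronglyMeasurableAtFilter _ _) hc.continuousAt
    rw [Real.toNNReal_zero, hT.apply_zero, hasDerivAt_iff_tendsto_slope_zero] at hd
    have hco : Tendsto (fun r : ℝ≥0 => (r : ℝ)) (𝓝[>] 0) (𝓝[≠] 0) := by
      refine tendsto_nhdsWithin_iff.2 ⟨?_, ?_⟩
      · exact (NNReal.continuous_coe.tendsto' 0 0 rfl).mono_left nhdsWithin_le_nhds
      · filter_upwards [self_mem_nhdsWithin] with r hr
        exact NNReal.coe_ne_zero.2 (ne_of_gt hr)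
    refine (hd.comp hco).congr fun r => ?_
    simp [hX]
  have hmem : ∀ h : ℝ≥0, (h : ℝ)⁻¹ • X h ∈ {u : E | ∃ w, (u, w) ∈ generatorGraph T} := by
    intro h
    refine ⟨(h : ℝ)⁻¹ • (T h f - f), mem_generatorGraph_iff.2 ?_⟩
    have h1 := ((((T h).continuous.tendsto f).comp hlim).sub hlim).const_smul ((h : ℝ)⁻¹)
    have hsm : ∀ (t : ℝ≥0) (c : ℝ) (x : E), T t (c • x) = c • T t x := fun t c x => by
      rw [RCLike.real_smul_eq_coe_smul (K := 𝕜), map_smul, ← RCLike.real_smul_eq_coe_smul]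
    refine h1.congr fun r => ?_
    -- Expanding `X (r + h)` in both orders moves the increment in `r` onto `X r`, whose quotient by
    -- `r` tends to `f`.
    have h2 : T r (X h) - X h = T h (X r) - X r := by
      have := hadd r h
      rw [add_comm r h, hadd h r] at this
      rw [sub_eq_sub_iff_add_eq_add, add_comm, ← this, add_comm]
    simp only [Function.comp_apply, hsm]
    rw [← smul_sub, ← smul_sub, h2, smul_comm]
  exact mem_closure_of_tendsto hlim (Eventually.of_forall hmem)

theorem continuous_uncurry [CompleteSpace E] (hT : IsC0Semigroup T) {M : ℝ}
    (hM : ∀ t, ‖T t‖ ≤ M) : Continuous fun p : ℝ≥0 × E => T p.1 p.2 := by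
  rw [continuous_iff_continuousAt]
  rintro ⟨t, f⟩
  have h1 : Tendsto (fun p : ℝ≥0 × E => M * ‖p.2 - f‖ + ‖T p.1 f - T t f‖) (𝓝 (t, f)) (𝓝 0) := by
    have : Continuous fun p : ℝ≥0 × E => M * ‖p.2 - f‖ + ‖T p.1 f - T t f‖ := by
      exact ((continuous_snd.sub continuous_const).norm.const_mul M).add
        (((hT.continuous_orbit f).comp continuous_fst).sub continuous_const).norm
    simpa using this.tendsto (t, f)
  refine tendsto_iff_norm_sub_tendsto_zero.2 (squeeze_zero (fun p => norm_nonneg _) ?_ h1)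
  intro p
  calc ‖T p.1 p.2 - T t f‖ = ‖T p.1 (p.2 - f) + (T p.1 f - T t f)‖ := by
        rw [map_sub]; congr 1; abel
    _ ≤ _ := (norm_add_le _ _).trans (by gcongr; exact (T p.1).le_of_opNorm_le (hM _) _)

/-- Rescaling a `C₀`-semigroup by `exp (a t)` adds `a` to the generator. -/
theorem rescale [NormedSpace ℝ E] [IsScalarTower ℝ 𝕜 E] (hT : IsC0Semigroup T) (a : ℝ) :
    IsC0Semigroup (fun t => ((Real.exp (a * t) : ℝ) : 𝕜) • T t) ∧
    generatorGraph (fun t => ((Real.exp (a * t) : ℝ) : 𝕜) • T t) =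
      {q | (q.1, q.2 - a • q.1) ∈ generatorGraph T} := by
  have hsm : ∀ (t : ℝ≥0) (x : E), (((Real.exp (a * t) : ℝ) : 𝕜) • T t) x
      = Real.exp (a * t) • T t x := fun t x => by
    rw [RCLike.real_smul_eq_coe_smul (K := 𝕜)]; rfl
  have he : Tendsto (fun t : ℝ≥0 => Real.exp (a * t)) (𝓝 0) (𝓝 1) :=
    Continuous.tendsto' (by fun_prop) _ _ (by simp)
  refine ⟨⟨?_, ?_, ?_⟩, ?_⟩
  · simp [hT.map_zero]
  · intro s t
    rw [hT.map_add, ContinuousLinearMap.smul_comp, ContinuousLinearMap.comp_smul, smul_smul,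
      ← RCLike.ofReal_mul, ← Real.exp_add, NNReal.coe_add, mul_add]
  · intro f
    simp only [hsm]
    simpa using he.smul (hT.tendsto_zero f)
  · have hco : Tendsto (fun r : ℝ≥0 => (r : ℝ)) (𝓝[>] 0) (𝓝[≠] 0) := by
      refine tendsto_nhdsWithin_iff.2 ⟨?_, ?_⟩
      · exact (NNReal.continuous_coe.tendsto' 0 0 rfl).mono_left nhdsWithin_le_nhds
      · filter_upwards [self_mem_nhdsWithin] with r hr
        exact NNReal.coe_ne_zero.2 (ne_of_gt hr)
    have hda : Tendsto (fun t : ℝ≥0 => (t : ℝ)⁻¹ * (Real.exp (a * t) - 1)) (𝓝[>] 0) (𝓝 a) := by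
      have hd : HasDerivAt (fun x : ℝ => Real.exp (a * x)) a 0 := by
        have := ((hasDerivAt_id (0 : ℝ)).const_mul a).exp
        simpa using this
      rw [hasDerivAt_iff_tendsto_slope_zero] at hd
      refine (hd.comp hco).congr fun r => ?_
      simp
    have he' := he.mono_left (nhdsWithin_le_nhds (s := Ioi 0))
    ext ⟨u, w⟩
    simp only [mem_ofPred_eq]
    rw [mem_generatorGraph_iff, mem_generatorGraph_iff]
    simp only [hsm]
    constructor
    · intro h
      have hl := (he'.inv₀ one_ne_zero).smul (h.sub (hda.smul_const u))
      simp only [inv_one, one_smul] at hl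
      refine hl.congr fun t => ?_
      have := Real.exp_ne_zero (a * t)
      rw [mul_smul, ← smul_sub, sub_smul, one_smul, sub_sub_sub_cancel_right, ← smul_sub,
        smul_comm, inv_smul_smul₀ this]
    · intro h
      have hl := (he'.smul h).add (hda.smul_const u)
      simp only [one_smul, sub_add_cancel] at hl
      refine hl.congr fun t => ?_
      rw [mul_smul, smul_comm, ← smul_add, sub_smul, one_smul, smul_sub, sub_add_sub_cancel]

/-- Perturbation of an exponentially decaying `C₀`-semigroup by a bounded operator that is small
compared with the decay rate. -/
theorem exists_perturbation_of_norm_lt [NormedSpace ℝ E] [IsScalarTower ℝ 𝕜 E] [CompleteSpace E]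
    (hT : IsC0Semigroup T) {ω : ℝ} (hω : 0 < ω) (hdecay : ∀ t, ‖T t‖ ≤ Real.exp (-ω * t))
    (B : E →L[𝕜] E) (hB : ‖B‖ < ω) :
    ∃ S : ℝ≥0 → E →L[𝕜] E, IsC0Semigroup S ∧
      generatorGraph S = {q | (q.1, q.2 - B q.1) ∈ generatorGraph T} := by
  have hT1 : ∀ t, ‖T t‖ ≤ 1 := fun t =>
    (hdecay t).trans (Real.exp_le_one_iff.2 (by have := t.coe_nonneg; nlinarith))
  have hcT := hT.continuous_uncurry hT1
  -- Variation of constants: the orbit `u` of the perturbed semigroup solves `u = T(·)f + K u` with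
  -- `(K u)(t) = ∫₀ᵗ T(t-s) B u(s) ds`. The decay of `T` gives `‖K‖ ≤ ‖B‖/ω < 1` on bounded
  -- continuous functions, so a Neumann series solves it on all of `[0,∞)` at once.
  set F : (ℝ≥0 →ᵇ E) → ℝ → ℝ → E := fun u t s => T (t - s).toNNReal (B (u s.toNNReal)) with hF
  have hFc : ∀ u, Continuous fun p : ℝ × ℝ => F u p.1 p.2 := fun u =>
    hcT.comp ((continuous_real_toNNReal.comp (continuous_fst.sub continuous_snd)).prodMk
      (B.continuous.comp (u.continuous.comp (continuous_real_toNNReal.comp continuous_snd))))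
  have hFc' : ∀ u t, Continuous (F u t) := fun u t =>
    (hFc u).comp (continuous_const.prodMk continuous_id)
  set Y : (ℝ≥0 →ᵇ E) → ℝ≥0 → E := fun u t => ∫ s in (0 : ℝ)..t, F u t s with hY
  have hYc : ∀ u, Continuous (Y u) := fun u =>
    (intervalIntegral.continuous_parametric_intervalIntegral_of_continuous
      (f := F u) (hFc u) continuous_id).comp NNReal.continuous_coe
  have hYb : ∀ u t, ‖Y u t‖ ≤ ‖B‖ / ω * ‖u‖ := by
    intro u t
    have h1 : ∀ s ∈ Ioc (0 : ℝ) t, ‖F u t s‖ ≤ Real.exp (-ω * (t - s)) * (‖B‖ * ‖u‖) := by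
      intro s hs
      have h2 : ((t - s : ℝ).toNNReal : ℝ) = t - s := Real.coe_toNNReal _ (sub_nonneg.2 hs.2)
      have h3 := hdecay (t - s : ℝ).toNNReal
      rw [h2] at h3
      refine ((T _).le_of_opNorm_le h3 _).trans ?_
      gcongr
      exact (B.le_opNorm _).trans (by gcongr; exact u.norm_coe_le_norm _)
    have hint : ∫ s in (0 : ℝ)..t, Real.exp (-ω * (t - s)) * (‖B‖ * ‖u‖)
        = (1 - Real.exp (-ω * t)) / ω * (‖B‖ * ‖u‖) := by
      rw [intervalIntegral.integral_mul_const]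
      congr 1
      rw [intervalIntegral.integral_eq_sub_of_hasDerivAt
        (f := fun s => Real.exp (-ω * (t - s)) / ω) ?_ (Continuous.intervalIntegrable
          (by fun_prop) _ _)]
      · simp [sub_div]
      · intro s _
        have := ((((hasDerivAt_id' s).const_sub (t : ℝ)).const_mul (-ω)).exp).div_const ω
        refine HasDerivAt.congr_deriv this ?_
        field_simp
    calc ‖Y u t‖ ≤ ∫ s in (0 : ℝ)..t, Real.exp (-ω * (t - s)) * (‖B‖ * ‖u‖) :=
          intervalIntegral.norm_integral_le_of_norm_le t.coe_nonneg
            (Eventually.of_forall h1) (Continuous.intervalIntegrable (by fun_prop) _ _)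
      _ = (1 - Real.exp (-ω * t)) / ω * (‖B‖ * ‖u‖) := hint
      _ ≤ 1 / ω * (‖B‖ * ‖u‖) := by
          gcongr
          linarith [Real.exp_pos (-ω * t)]
      _ = _ := by ring
  let K0 : (ℝ≥0 →ᵇ E) →ₗ[𝕜] (ℝ≥0 →ᵇ E) :=
    { toFun := fun u => BoundedContinuousFunction.ofNormedAddCommGroup (Y u) (hYc u) _ (hYb u)
      map_add' := fun u v => by
        ext t
        change Y (u + v) t = Y u t + Y v t
        have : F (u + v) t = fun s => F u t s + F v t s := by
          ext s
          change T _ (B ((u + v) _)) = T _ (B (u _)) + T _ (B (v _))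
          rw [BoundedContinuousFunction.add_apply, _root_.map_add, _root_.map_add]
        change ∫ s in (0 : ℝ)..t, F (u + v) t s = _
        rw [this, intervalIntegral.integral_add ((hFc' u t).intervalIntegrable _ _)
          ((hFc' v t).intervalIntegrable _ _)]
      map_smul' := fun c u => by
        ext t
        change Y (c • u) t = c • Y u t
        have : F (c • u) t = fun s => c • F u t s := by
          ext s
          change T _ (B ((c • u) _)) = c • T _ (B (u _))
          rw [BoundedContinuousFunction.smul_apply, map_smul, map_smul]
        change ∫ s in (0 : ℝ)..t, F (c • u) t s = _
        rw [this, intervalIntegral.integral_smul] }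
  have hK0 : ∀ u : ℝ≥0 →ᵇ E, ‖K0 u‖ ≤ ‖B‖ / ω * ‖u‖ := by
    intro u
    exact BoundedContinuousFunction.norm_ofNormedAddCommGroup_le _ (by positivity) (hYb u)
  let K : (ℝ≥0 →ᵇ E) →L[𝕜] (ℝ≥0 →ᵇ E) := K0.mkContinuous _ hK0
  have hK : ‖K‖ < 1 := (LinearMap.mkContinuous_norm_le _ (by positivity) _).trans_lt
    ((div_lt_one hω).2 hB)
  have hKY : ∀ u t, K u t = Y u t := fun u t => rfl
  let O0 : E →ₗ[𝕜] (ℝ≥0 →ᵇ E) :=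
    { toFun := fun f => BoundedContinuousFunction.ofNormedAddCommGroup (fun t => T t f)
        (hT.continuous_orbit f) (1 * ‖f‖) (fun t => (T t).le_of_opNorm_le (hT1 t) f)
      map_add' := fun f g => by ext t; simp
      map_smul' := fun c f => by ext t; simp }
  have hO0 : ∀ f : E, ‖O0 f‖ ≤ 1 * ‖f‖ := by
    intro f
    exact BoundedContinuousFunction.norm_ofNormedAddCommGroup_le _ (by positivity)
      (fun t => (T t).le_of_opNorm_le (hT1 t) f)
  let O : E →L[𝕜] (ℝ≥0 →ᵇ E) := O0.mkContinuous 1 hO0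
  have hO : ∀ f t, O f t = T t f := fun f t => rfl
  let N : (ℝ≥0 →ᵇ E) →L[𝕜] (ℝ≥0 →ᵇ E) := ((Units.oneSub K hK)⁻¹ : Units _)
  have hN1 : ∀ u, N u - K (N u) = u := fun u => by
    have : ((1 - K) * N) u = u := by
      change (((Units.oneSub K hK : Units _) : (ℝ≥0 →ᵇ E) →L[𝕜] (ℝ≥0 →ᵇ E)) * _) u = u
      rw [Units.mul_inv]; rfl
    exact this
  have hN2 : ∀ u, N (u - K u) = u := fun u => by
    have : (N * (1 - K)) u = u := by
      change (_ * ((Units.oneSub K hK : Units _) : (ℝ≥0 →ᵇ E) →L[𝕜] (ℝ≥0 →ᵇ E))) u = u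
      rw [Units.inv_mul]; rfl
    exact this
  set S : ℝ≥0 → E →L[𝕜] E := fun t =>
    (BoundedContinuousFunction.evalCLM 𝕜 t).comp (N.comp O) with hS
  have hSu : ∀ f t, S t f = N (O f) t := fun f t => rfl
  have hSeq : ∀ f t, S t f = T t f + Y (N (O f)) t := fun f t => by
    have := congrArg (fun u : ℝ≥0 →ᵇ E => u t) (hN1 (O f))
    simp only [BoundedContinuousFunction.coe_sub, Pi.sub_apply, hKY, hO] at this
    rw [hSu, ← this]; abel
  have hY0 : ∀ u, Y u 0 = 0 := fun u => by simp [hY]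
  have hYshift : ∀ (u : ℝ≥0 →ᵇ E) (s t : ℝ≥0),
      Y u (t + s) = T t (Y u s) + ∫ r in (0 : ℝ)..t, T (t - r).toNNReal (B (u (r.toNNReal + s))) := by
    intro u s t
    have h1 : T t (Y u s) = ∫ r in (0 : ℝ)..s, F u (t + s) r := by
      rw [hY, ← ContinuousLinearMap.intervalIntegral_comp_comm _
        ((hFc' u s).intervalIntegrable _ _)]
      refine intervalIntegral.integral_congr fun r hr => ?_
      rw [uIcc_of_le s.coe_nonneg] at hr
      change T t (T (s - r).toNNReal (B (u r.toNNReal))) = T (t + s - r).toNNReal (B (u r.toNNReal))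
      rw [add_sub_assoc, Real.toNNReal_add t.coe_nonneg (sub_nonneg.2 hr.2), Real.toNNReal_coe,
        hT.apply_add]
    have h2 : ∫ r in (0 : ℝ)..t, T (t - r).toNNReal (B (u (r.toNNReal + s)))
        = ∫ r in (s : ℝ)..(t + s : ℝ), F u (t + s) r := by
      have := intervalIntegral.integral_comp_add_right (a := 0) (b := (t : ℝ))
        (fun r => F u (t + s) r) (s : ℝ)
      rw [zero_add] at this
      rw [← this]
      refine intervalIntegral.integral_congr fun r hr => ?_
      rw [uIcc_of_le t.coe_nonneg] at hr
      change _ = T (t + s - (r + s)).toNNReal (B (u (r + s).toNNReal))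
      rw [Real.toNNReal_add hr.1 s.coe_nonneg, Real.toNNReal_coe, add_sub_add_right_eq_sub]
    rw [h1, h2, intervalIntegral.integral_add_adjacent_intervals
      ((hFc' u _).intervalIntegrable _ _) ((hFc' u _).intervalIntegrable _ _)]
    simp [hY]
  -- The shifted orbit `u(· + s)` solves the fixed point equation with initial value `S s f`;
  -- uniqueness gives the semigroup law.
  have hSadd : ∀ f s t, S (t + s) f = S t (S s f) := by
    intro f s t
    set u := N (O f) with hu
    let v : ℝ≥0 →ᵇ E := u.compContinuous ⟨fun t => t + s, by fun_prop⟩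
    have hv : ∀ t, v t = u (t + s) := fun t => rfl
    have hv1 : v - K v = O (S s f) := by
      ext t
      simp only [BoundedContinuousFunction.coe_sub, Pi.sub_apply, hKY, hO, hv]
      have h3 := hSeq f (t + s)
      rw [hSu, ← hu, hYshift, hT.apply_add t s f] at h3
      have h4 := hSeq f s
      rw [← hu] at h4
      rw [h3, h4, _root_.map_add]
      simp only [hY, hF, hv]
      abel
    have hv2 : v = N (O (S s f)) := by rw [← hv1, hN2]
    rw [hSu (S s f), ← hv2, hv]
    exact hSu f _
  -- The difference quotients of `S` and `T` at `f` thus differ by a term tending to `B f`, which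
  -- identifies the generator.
  have hYlim : ∀ u, Tendsto (fun t : ℝ≥0 => (t : ℝ)⁻¹ • Y u t) (𝓝[>] 0) (𝓝 (B (u 0))) := by
    intro u
    rw [Metric.tendsto_nhds]
    intro ε hε
    have hc := (hFc u).tendsto (0, 0)
    have h00 : F u 0 0 = B (u 0) := by simp [hF, hT.apply_zero]
    rw [h00] at hc
    obtain ⟨δ, hδ, hball⟩ := Metric.mem_nhds_iff.1 (hc (Metric.ball_mem_nhds _ (half_pos hε)))
    have hsmall : ∀ᶠ t : ℝ≥0 in 𝓝[>] 0, (t : ℝ) < δ := by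
      refine nhdsWithin_le_nhds ?_
      exact (NNReal.continuous_coe.tendsto' 0 0 rfl).eventually (gt_mem_nhds hδ)
    filter_upwards [hsmall, self_mem_nhdsWithin] with t ht ht0
    have ht0' : (0 : ℝ) < t := ht0
    have h1 : Y u t - (t : ℝ) • B (u 0) = ∫ s in (0 : ℝ)..t, (F u t s - B (u 0)) := by
      rw [intervalIntegral.integral_sub ((hFc' u t).intervalIntegrable _ _) (by simp)]
      simp [hY]
    have h2 : ‖Y u t - (t : ℝ) • B (u 0)‖ ≤ ε / 2 * |(t : ℝ) - 0| := by
      rw [h1]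
      refine intervalIntegral.norm_integral_le_of_norm_le_const fun s hs => ?_
      rw [uIoc_of_le ht0'.le] at hs
      have : ((t : ℝ), s) ∈ Metric.ball ((0 : ℝ), (0 : ℝ)) δ := by
        rw [Metric.mem_ball, Prod.dist_eq, max_lt_iff, Real.dist_0_eq_abs, Real.dist_0_eq_abs,
          abs_of_pos ht0', abs_of_pos hs.1]
        exact ⟨ht, hs.2.trans_lt ht⟩
      have := hball this
      rw [mem_preimage, Metric.mem_ball, dist_eq_norm] at this
      exact this.le
    rw [sub_zero, abs_of_pos ht0'] at h2
    have h3 : (t : ℝ)⁻¹ • Y u t - B (u 0) = (t : ℝ)⁻¹ • (Y u t - (t : ℝ) • B (u 0)) := by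
      rw [smul_sub, inv_smul_smul₀ ht0'.ne']
    rw [dist_eq_norm, h3, norm_smul, norm_inv, Real.norm_of_nonneg ht0'.le]
    calc (t : ℝ)⁻¹ * _ ≤ (t : ℝ)⁻¹ * (ε / 2 * t) := by gcongr
      _ = ε / 2 := by field_simp
      _ < ε := half_lt_self hε
  have hu0 : ∀ f, N (O f) 0 = f := fun f => by
    rw [← hSu, hSeq, hY0, hT.apply_zero, add_zero]
  refine ⟨S, ⟨?_, ?_, ?_⟩, ?_⟩
  · ext f
    rw [hSu, hu0]; rfl
  · intro s t
    ext f
    exact hSadd f t s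
  · intro f
    have := (N (O f)).continuous.tendsto 0
    rw [hu0] at this
    exact this
  · ext ⟨f, w⟩
    simp only [mem_ofPred_eq]
    rw [mem_generatorGraph_iff, mem_generatorGraph_iff]
    have hl := hYlim (N (O f))
    rw [hu0] at hl
    constructor
    · intro h
      refine (h.sub hl).congr fun t => ?_
      rw [hSeq, ← smul_sub]; congr 1; abel
    · intro h
      have := h.add hl
      rw [sub_add_cancel] at this
      refine this.congr fun t => ?_
      rw [hSeq, ← smul_add]; congr 1; abel

/-- The bounded perturbation theorem for contraction semigroups. -/
theorem exists_perturbation [NormedSpace ℝ E] [IsScalarTower ℝ 𝕜 E] [CompleteSpace E]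
    (hT : IsC0Semigroup T) (hcontr : ∀ t, ‖T t‖ ≤ 1) (B : E →L[𝕜] E) :
    ∃ S : ℝ≥0 → E →L[𝕜] E, IsC0Semigroup S ∧
      generatorGraph S = {q | (q.1, q.2 - B q.1) ∈ generatorGraph T} := by
  -- Damping by `exp (-ω t)` creates the decay needed; it is undone afterwards.
  set ω := ‖B‖ + 1
  have hω : 0 < ω := by positivity
  obtain ⟨h1, h2⟩ := hT.rescale (-ω)
  obtain ⟨S, hS, hSg⟩ := h1.exists_perturbation_of_norm_lt hω (fun t => by
    rw [norm_smul, RCLike.norm_ofReal, abs_of_pos (Real.exp_pos _)]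
    exact mul_le_of_le_one_right (Real.exp_pos _).le (hcontr t)) B (lt_add_one _)
  obtain ⟨h3, h4⟩ := hS.rescale ω
  refine ⟨_, h3, ?_⟩
  rw [h4, hSg, h2]
  ext ⟨f, w⟩
  simp only [mem_ofPred_eq]
  rw [show w - ω • f - B f - -ω • f = w - B f by rw [neg_smul]; abel]

end IsC0Semigroup

/-- A continuous function whose right upper derivative is at most `C` everywhere grows at most
linearly with slope `C`. -/
theorem le_add_mul_of_right_slope_le {φ : ℝ≥0 → ℝ} (hφ : Continuous φ) {C : ℝ}
    (h : ∀ s, ∃ ℓ ≤ C, ∃ g : ℝ≥0 → ℝ, Tendsto g (𝓝[>] 0) (𝓝 ℓ) ∧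
      ∀ r, 0 < r → φ (s + r) - φ s ≤ r * g r) (t : ℝ≥0) : φ t ≤ φ 0 + C * t := by
  -- The comparison principle needs a strictly larger slope.
  have key : ∀ δ > 0, φ t ≤ φ 0 + (C + δ) * t := by
    intro δ hδ
    have hcont : Continuous fun x : ℝ => φ x.toNNReal := hφ.comp continuous_real_toNNReal
    have := image_le_of_liminf_slope_right_lt_deriv_boundary' (f := fun x : ℝ => φ x.toNNReal)
      (f' := fun _ => C) (a := 0) (b := t) hcont.continuousOn ?_
      (B := fun x => φ 0 + (C + δ) * x) (B' := fun _ => C + δ) (by simp) (by fun_prop)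
      (fun x _ => ?_) (fun x _ _ => by linarith) (right_mem_Icc.2 t.coe_nonneg)
    · simpa using this
    · intro x hx r hr
      obtain ⟨ℓ, hℓ, g, hg, hle⟩ := h x.toNNReal
      have hev : ∀ᶠ y : ℝ≥0 in 𝓝[>] 0, g y < r := hg.eventually (gt_mem_nhds (hℓ.trans_lt hr))
      have hmap : Tendsto (fun z : ℝ => (z - x).toNNReal) (𝓝[>] x) (𝓝[>] 0) := by
        refine tendsto_nhdsWithin_iff.2 ⟨?_, ?_⟩
        · exact (Continuous.tendsto' (by fun_prop) _ _ (by simp)).mono_left nhdsWithin_le_nhds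
        · filter_upwards [self_mem_nhdsWithin] with z hz
          simpa using hz
      refine Eventually.frequently ?_
      filter_upwards [hmap.eventually hev, self_mem_nhdsWithin] with z hz hxz
      have hxz' : 0 < z - x := sub_pos.2 hxz
      have h1 := hle (z - x).toNNReal (Real.toNNReal_pos.2 hxz')
      rw [← Real.toNNReal_add hx.1 hxz'.le, add_sub_cancel, Real.coe_toNNReal _ hxz'.le] at h1
      rw [slope_def_field, div_lt_iff₀ hxz']
      nlinarith
    · have := ((hasDerivAt_id x).const_mul (C + δ)).const_add (φ 0)
      simpa using this.hasDerivWithinAt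
  refine le_of_forall_pos_le_add fun δ hδ => ?_
  have h1 := key (δ / (t + 1)) (by positivity)
  have h2 : δ / ((t : ℝ) + 1) * t ≤ δ := by
    rw [div_mul_eq_mul_div, div_le_iff₀ (by positivity)]
    nlinarith
  linarith [add_mul C (δ / ((t : ℝ) + 1)) t]

end Semigroup

section HalfLine

variable {𝕜 : Type*} [RCLike 𝕜]

/-! ### Multiplication operators -/

/-- Multiplication by a bounded real function, as an operator on `L₂(0, ∞)`. -/
theorem exists_mulOperator (𝕜 : Type*) [RCLike 𝕜] {W : ℝ → ℝ} (hW : AEMeasurable W halfLine)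
    {C : ℝ} (hC : ∀ᵐ x ∂halfLine, |W x| ≤ C) :
    ∃ B : HalfLineL2 𝕜 →L[𝕜] HalfLineL2 𝕜,
      ∀ u, B u =ᵐ[halfLine] fun x => W x • u x := by
  have hmem : ∀ u : HalfLineL2 𝕜, MemLp (fun x => W x • u x) 2 halfLine := fun u =>
    (Lp.memLp u).of_le_mul (c := C) (hW.aestronglyMeasurable.smul (Lp.aestronglyMeasurable u))
      (hC.mono fun x hx => by rw [norm_smul]; gcongr; exact hx)
  let B0 : HalfLineL2 𝕜 →ₗ[𝕜] HalfLineL2 𝕜 :=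
    { toFun := fun u => (hmem u).toLp _
      map_add' := fun u v => by
        refine Lp.ext ?_
        filter_upwards [(hmem (u + v)).coeFn_toLp, (hmem u).coeFn_toLp, (hmem v).coeFn_toLp,
          Lp.coeFn_add ((hmem u).toLp _) ((hmem v).toLp _), Lp.coeFn_add u v]
          with x h1 h2 h3 h4 h5
        rw [h1, h4, Pi.add_apply, h2, h3, h5, Pi.add_apply, smul_add]
      map_smul' := fun c u => by
        refine Lp.ext ?_
        filter_upwards [(hmem (c • u)).coeFn_toLp, (hmem u).coeFn_toLp,
          Lp.coeFn_smul c ((hmem u).toLp _), Lp.coeFn_smul c u]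
          with x h1 h2 h4 h5
        rw [h1, RingHom.id_apply, h4, Pi.smul_apply, h2, h5, Pi.smul_apply, smul_comm] }
  refine ⟨B0.mkContinuous C fun u => ?_, fun u => (hmem u).coeFn_toLp⟩
  refine Lp.norm_le_mul_norm_of_ae_le_mul ?_
  filter_upwards [(hmem u).coeFn_toLp, hC] with x h1 h2
  change ‖(hmem u).toLp _ x‖ ≤ _
  rw [h1, norm_smul]
  gcongr
  exact h2

theorem inner_mulOperator {B : HalfLineL2 𝕜 →L[𝕜] HalfLineL2 𝕜} {W : ℝ → ℝ}
    (hB : ∀ u, B u =ᵐ[halfLine] fun x => W x • u x) (u v : HalfLineL2 𝕜) :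
    inner ℝ (B u) v = ∫ x in Ioi (0 : ℝ), W x * inner ℝ (u x) (v x) := by
  rw [L2.inner_def]
  refine integral_congr_ae ((hB u).mono fun x hx => ?_)
  simp only
  rw [hx, real_inner_smul_left]

/-! ### The space `H¹₀(0, ∞)` -/

/-- The pairs of a test function and its derivative, in `L₂ × L₂`. -/
def testPairs (𝕜 : Type*) [RCLike 𝕜] : Set (HalfLineL2 𝕜 × HalfLineL2 𝕜) :=
  {q | ∃ φ : HalfLineTest 𝕜, q.1 =ᵐ[halfLine] φ ∧ q.2 =ᵐ[halfLine] deriv φ}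

theorem HalfLineTest.contDiff_one (φ : HalfLineTest 𝕜) : ContDiff ℝ 1 φ :=
  φ.contDiff.of_le (by exact_mod_cast le_top)

theorem HalfLineTest.eq_zero (φ : HalfLineTest 𝕜) {x : ℝ} (hx : x ≤ 0) : φ x = 0 := by
  by_contra h
  exact absurd (φ.tsupport_subset (subset_tsupport _ h)) (not_lt.2 hx)

theorem sub_mem_testPairs {p q : HalfLineL2 𝕜 × HalfLineL2 𝕜} (hp : p ∈ testPairs 𝕜)
    (hq : q ∈ testPairs 𝕜) : p - q ∈ testPairs 𝕜 := by
  obtain ⟨φ, h1, h2⟩ := hp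
  obtain ⟨ψ, h3, h4⟩ := hq
  refine ⟨φ - ψ, ?_, ?_⟩
  · filter_upwards [h1, h3, Lp.coeFn_sub p.1 q.1] with x h1 h3 h
    rw [Prod.fst_sub, h, Pi.sub_apply, h1, h3]; rfl
  · filter_upwards [h2, h4, Lp.coeFn_sub p.2 q.2] with x h1 h3 h
    rw [Prod.snd_sub, h, Pi.sub_apply, h1, h3]
    exact (deriv_sub ((HalfLineTest.contDiff_one φ).differentiable one_ne_zero x)
      ((HalfLineTest.contDiff_one ψ).differentiable one_ne_zero x)).symm

theorem sub_mem_closure_testPairs {p q : HalfLineL2 𝕜 × HalfLineL2 𝕜}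
    (hp : p ∈ closure (testPairs 𝕜)) (hq : q ∈ closure (testPairs 𝕜)) :
    p - q ∈ closure (testPairs 𝕜) :=
  map_mem_closure₂ continuous_sub hp hq fun _ ha _ hb => sub_mem_testPairs ha hb

/-- Since `φ(0) = 0`, `φ(x)` is the inner product of `φ'` with the indicator of `(0, x]`, which has
norm `√x`. -/
theorem norm_testFunction_le {φ : HalfLineTest 𝕜} {v : HalfLineL2 𝕜} (hv : v =ᵐ[halfLine] deriv φ)
    {x : ℝ} (hx : 0 < x) : ‖φ x‖ ≤ √x * ‖v‖ := by
  have h0 : φ x = ∫ y in (0 : ℝ)..x, deriv φ y := by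
    rw [intervalIntegral.integral_deriv_eq_sub
      (fun y _ => (HalfLineTest.contDiff_one φ).differentiable one_ne_zero y)
      (((HalfLineTest.contDiff_one φ).continuous_deriv le_rfl).intervalIntegrable _ _),
      HalfLineTest.eq_zero φ le_rfl, sub_zero]
  have hs : (halfLine (Ioc 0 x)) = ENNReal.ofReal x := by
    rw [Measure.restrict_apply measurableSet_Ioc,
      inter_eq_left.2 (Ioc_subset_Ioi_self), Real.volume_Ioc, sub_zero]
  have hs' : halfLine (Ioc 0 x) ≠ ∞ := by rw [hs]; exact ENNReal.ofReal_ne_top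
  have h1 : φ x = inner 𝕜 (indicatorConstLp 2 measurableSet_Ioc hs' (1 : 𝕜)) v := by
    rw [L2.inner_indicatorConstLp_one, h0, intervalIntegral.integral_of_le hx.le,
      setIntegral_congr_ae measurableSet_Ioc (hv.mono fun y hy _ => hy),
      Measure.restrict_restrict measurableSet_Ioc, inter_eq_left.2 (Ioc_subset_Ioi_self)]
  rw [h1]
  refine (norm_inner_le_norm _ _).trans_eq ?_
  rw [norm_indicatorConstLp two_ne_zero ENNReal.ofNat_ne_top, measureReal_def, hs,
    ENNReal.toReal_ofReal hx.le, norm_one, one_mul, Real.sqrt_eq_rpow]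
  norm_num

/-- A Hardy type inequality: a bounded potential `W` with `x W(x)` integrable is form bounded with
respect to the Dirichlet Laplacian. -/
theorem abs_inner_mulOperator_le {B : HalfLineL2 𝕜 →L[𝕜] HalfLineL2 𝕜} {W : ℝ → ℝ}
    (hB : ∀ u, B u =ᵐ[halfLine] fun x => W x • u x)
    (hW : IntegrableOn (fun x => x * |W x|) (Ioi 0))
    {a b : HalfLineL2 𝕜 × HalfLineL2 𝕜} (ha : a ∈ closure (testPairs 𝕜))
    (hb : b ∈ closure (testPairs 𝕜)) :
    |inner ℝ (B a.1) b.1| ≤ (∫ x in Ioi (0 : ℝ), x * |W x|) * (‖a.2‖ * ‖b.2‖) := by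
  have hcl : IsClosed {p : (HalfLineL2 𝕜 × HalfLineL2 𝕜) × (HalfLineL2 𝕜 × HalfLineL2 𝕜) |
      |inner ℝ (B p.1.1) p.2.1| ≤ (∫ x in Ioi (0 : ℝ), x * |W x|) * (‖p.1.2‖ * ‖p.2.2‖)} := by
    refine isClosed_le (Continuous.abs ?_) (by fun_prop)
    exact Continuous.inner (by fun_prop) (by fun_prop)
  have hab : (a, b) ∈ closure (testPairs 𝕜 ×ˢ testPairs 𝕜) := by
    rw [closure_prod_eq]; exact ⟨ha, hb⟩
  refine closure_minimal ?_ hcl hab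
  rintro ⟨p, q⟩ ⟨⟨φ, h1, h2⟩, ψ, h3, h4⟩
  simp only [mem_ofPred_eq]
  rw [inner_mulOperator hB, ← Real.norm_eq_abs, ← integral_mul_const]
  refine norm_integral_le_of_norm_le (hW.mul_const _) ?_
  filter_upwards [h1, h3, ae_restrict_mem measurableSet_Ioi] with x h1 h3 hx
  have hx : 0 < x := hx
  rw [h1, h3, norm_mul, Real.norm_eq_abs]
  calc |W x| * ‖inner ℝ (φ x) (ψ x)‖ ≤ |W x| * ((√x * ‖p.2‖) * (√x * ‖q.2‖)) := by
        gcongr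
        exact (norm_inner_le_norm _ _).trans (mul_le_mul (norm_testFunction_le h2 hx)
          (norm_testFunction_le h4 hx) (norm_nonneg _) (by positivity))
    _ = (√x * √x) * |W x| * (‖p.2‖ * ‖q.2‖) := by ring
    _ = _ := by rw [Real.mul_self_sqrt hx.le]

/-- Uniform closeness with a common finite-measure support set gives closeness in `L₂`; used for
mollification. -/
theorem norm_sub_le_of_uniform {u v : HalfLineL2 𝕜} {g h : ℝ → 𝕜} (hu : u =ᵐ[halfLine] g)
    (hv : v =ᵐ[halfLine] h) {K : Set ℝ} (hK : MeasurableSet K) (hK' : halfLine K ≠ ∞) {η : ℝ}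
    (hη : ∀ x, ‖g x - h x‖ ≤ η) (hoff : ∀ x ∉ K, g x = h x) :
    ‖u - v‖ ≤ η * √(halfLine.real K) := by
  have hη0 : 0 ≤ η := (norm_nonneg _).trans (hη 0)
  have h1 : ‖u - v‖ ≤ ‖indicatorConstLp 2 hK hK' η‖ := by
    refine Lp.norm_le_norm_of_ae_le ?_
    filter_upwards [hu, hv, Lp.coeFn_sub u v, indicatorConstLp_coeFn (p := 2) (hs := hK)
      (hμs := hK') (c := η)] with x h1 h2 h3 h4
    rw [h3, h4, Pi.sub_apply, h1, h2]
    by_cases hx : x ∈ K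
    · rw [indicator_of_mem hx, Real.norm_of_nonneg hη0]; exact hη x
    · rw [indicator_of_notMem hx, hoff x hx]; simp
  rw [norm_indicatorConstLp two_ne_zero ENNReal.ofNat_ne_top, Real.norm_of_nonneg hη0] at h1
  rw [Real.sqrt_eq_rpow]
  simpa using h1

/-- Compactly supported `C¹` functions on `(0, ∞)` belong to `H¹₀(0, ∞)`. -/
theorem mem_closure_testPairs_of_contDiff {g : ℝ → 𝕜} (hg : ContDiff ℝ 1 g)
    (hgc : HasCompactSupport g) (hgs : tsupport g ⊆ Ioi 0) {u v : HalfLineL2 𝕜}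
    (hu : u =ᵐ[halfLine] g) (hv : v =ᵐ[halfLine] deriv g) :
    (u, v) ∈ closure (testPairs 𝕜) := by
  obtain ⟨r, hr, hrs⟩ : ∃ r : ℝ, 0 < r ∧ Metric.cthickening r (tsupport g) ⊆ Ioi 0 :=
    IsCompact.exists_cthickening_subset_open hgc isOpen_Ioi hgs
  set K := Metric.cthickening r (tsupport g)
  have hKc : IsCompact K := hgc.isCompact.cthickening
  have hK' : halfLine K ≠ ∞ := hKc.measure_lt_top.ne
  rw [Metric.mem_closure_iff]
  intro ε hε
  set m := √(halfLine.real K)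
  have hm : 0 ≤ m := Real.sqrt_nonneg _
  set η := ε / (2 * (m + 1)) with hη
  have hη0 : 0 < η := by positivity
  have hηm : η * m < ε := by
    rw [hη, div_mul_eq_mul_div, div_lt_iff₀ (by positivity)]
    nlinarith
  have hgd : Continuous (deriv g) := hg.continuous_deriv le_rfl
  obtain ⟨δ1, hδ1, hd1⟩ := Metric.uniformContinuous_iff.1
    (hgc.uniformContinuous_of_continuous hg.continuous) η hη0
  obtain ⟨δ2, hδ2, hd2⟩ := Metric.uniformContinuous_iff.1
    (hgc.deriv.uniformContinuous_of_continuous hgd) η hη0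
  -- The mollification radius keeps the support inside `(0,∞)` and lies below the moduli of
  -- continuity of `g` and of `g'` for `η`.
  set δ := min r (min δ1 δ2)
  have hδ : 0 < δ := lt_min hr (lt_min hδ1 hδ2)
  let ρ : ContDiffBump (0 : ℝ) := ⟨δ / 2, δ, half_pos hδ, half_lt_self hδ⟩
  have hρi : LocallyIntegrable (ρ.normed volume) volume := ρ.continuous_normed.locallyIntegrable
  set Φ := MeasureTheory.convolution (ρ.normed volume) g (ContinuousLinearMap.lsmul ℝ ℝ) volume
    with hΦ
  have hΦd : deriv Φ = MeasureTheory.convolution (ρ.normed volume) (deriv g)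
      (ContinuousLinearMap.lsmul ℝ ℝ) volume := by
    ext x
    exact (hgc.hasDerivAt_convolution_right _ hρi hg x).deriv
  have happ1 : ∀ x, ‖g x - Φ x‖ ≤ η := fun x => by
    rw [← dist_eq_norm, dist_comm]
    refine ContDiffBump.dist_normed_convolution_le hg.continuous.aestronglyMeasurable
      fun y hy => (hd1 (lt_of_lt_of_le (Metric.mem_ball.1 hy) ?_)).le
    exact (min_le_right _ _).trans (min_le_left _ _)
  have happ2 : ∀ x, ‖deriv g x - deriv Φ x‖ ≤ η := fun x => by
    rw [← dist_eq_norm, dist_comm, hΦd]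
    refine ContDiffBump.dist_normed_convolution_le hgd.aestronglyMeasurable
      fun y hy => (hd2 (lt_of_lt_of_le (Metric.mem_ball.1 hy) ?_)).le
    exact (min_le_right _ _).trans (min_le_right _ _)
  have hsupp : Function.support Φ ⊆ K := by
    refine (support_convolution_subset _).trans ?_
    rw [ρ.support_normed_eq]
    rintro _ ⟨a, ha, y, hy, rfl⟩
    refine Metric.mem_cthickening_of_dist_le _ y _ _ (subset_tsupport _ hy) ?_
    rw [mem_ball_zero_iff] at ha
    simpa using ha.le.trans (min_le_left _ _)
  have hts : tsupport Φ ⊆ K := closure_minimal hsupp Metric.isClosed_cthickening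
  have hΦs : ContDiff ℝ ((⊤ : ℕ∞) : WithTop ℕ∞) Φ :=
    ρ.hasCompactSupport_normed.contDiff_convolution_left _ ρ.contDiff_normed
      hg.continuous.locallyIntegrable
  have hΦc : HasCompactSupport Φ := hKc.of_isClosed_subset (isClosed_tsupport _) hts
  let φ : HalfLineTest 𝕜 := ⟨Φ, hΦs, hΦc, hts.trans hrs⟩
  have hΦ1 : ContDiff ℝ 1 Φ := hΦs.of_le (by exact_mod_cast le_top)
  have hm1 : MemLp Φ 2 halfLine := hΦ1.continuous.memLp_of_hasCompactSupport hΦc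
  have hm2 : MemLp (deriv Φ) 2 halfLine :=
    (hΦ1.continuous_deriv le_rfl).memLp_of_hasCompactSupport hΦc.deriv
  have hgK : tsupport g ⊆ K := Metric.self_subset_cthickening _
  refine ⟨(hm1.toLp _, hm2.toLp _), ⟨φ, hm1.coeFn_toLp, hm2.coeFn_toLp⟩, ?_⟩
  rw [Prod.dist_eq, max_lt_iff, dist_eq_norm, dist_eq_norm]
  constructor
  · refine (norm_sub_le_of_uniform hu hm1.coeFn_toLp hKc.measurableSet hK' happ1
      fun x hx => ?_).trans_lt hηm
    rw [image_eq_zero_of_notMem_tsupport fun h => hx (hgK h),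
      image_eq_zero_of_notMem_tsupport fun h => hx (hts h)]
  · refine (norm_sub_le_of_uniform hv hm2.coeFn_toLp hKc.measurableSet hK' happ2
      fun x hx => ?_).trans_lt hηm
    rw [image_eq_zero_of_notMem_tsupport fun h => hx (hgK (tsupport_deriv_subset h)),
      image_eq_zero_of_notMem_tsupport fun h => hx (hts (tsupport_deriv_subset h))]

/-! ### Integration by parts and Green's formula -/

theorem integral_inner_deriv_eq_neg {f g : ℝ → 𝕜} (hf : ContDiff ℝ 1 f) (hg : ContDiff ℝ 1 g)
    (hgc : HasCompactSupport g) (hgs : tsupport g ⊆ Ioi 0) :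
    ∫ x in Ioi (0 : ℝ), inner ℝ (deriv f x) (g x) =
      -∫ x in Ioi (0 : ℝ), inner ℝ (f x) (deriv g x) := by
  have hfd := hf.continuous_deriv le_rfl
  have hgd := hg.continuous_deriv le_rfl
  have hg0 : ∀ x ∉ Ioi (0 : ℝ), g x = 0 := fun x hx =>
    image_eq_zero_of_notMem_tsupport fun h => hx (hgs h)
  have hg0' : ∀ x ∉ Ioi (0 : ℝ), deriv g x = 0 := fun x hx =>
    image_eq_zero_of_notMem_tsupport fun h => hx (hgs (tsupport_deriv_subset h))
  rw [setIntegral_eq_integral_of_forall_compl_eq_zero fun x hx => by rw [hg0 x hx, inner_zero_right],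
    setIntegral_eq_integral_of_forall_compl_eq_zero fun x hx => by rw [hg0' x hx, inner_zero_right]]
  have hint : ∀ {p q : ℝ → 𝕜}, Continuous p → Continuous q → HasCompactSupport q →
      Integrable fun x => inner ℝ (p x) (q x) := fun {p q} hp hq hqc =>
    (hp.inner hq).integrable_of_hasCompactSupport (hqc.mono fun x hx h => hx (by simp [h]))
  have h : ∫ x, inner ℝ (f x) (deriv g x) = -∫ x, inner ℝ (deriv f x) (g x) :=
    integral_bilinear_hasDerivAt_right_eq_neg_left_of_integrable (L := innerSL ℝ)
    (u := f) (v := g) (u' := deriv f) (v' := deriv g)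
    (fun x _ => (hf.differentiable one_ne_zero x).hasDerivAt)
    (fun x _ => (hg.differentiable one_ne_zero x).hasDerivAt)
    (hint hf.continuous hgd hgc.deriv) (hint hfd hg.continuous hgc)
    (hint hf.continuous hg.continuous hgc)
  rw [h, neg_neg]

/-- The energy estimates need only real parts, so `L₂` is treated as a real Hilbert space; this
links it to the `𝕜`-valued pairing. -/
theorem inner_real_eq_re_inner (f g : HalfLineL2 𝕜) :
    inner ℝ f g = RCLike.re (inner 𝕜 f g) := by
  rw [L2.inner_def, L2.inner_def, ← integral_re (L2.integrable_inner f g)]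
  rfl

/-- The complex conjugate of a test function. -/
def HalfLineTest.conj (φ : HalfLineTest 𝕜) : HalfLineTest 𝕜 where
  toFun x := star (φ x)
  contDiff' := (RCLike.conjCLE (K := 𝕜)).contDiff.comp φ.contDiff
  hasCompactSupport' := φ.hasCompactSupport.comp_left (star_zero 𝕜)
  tsupport_subset' := (tsupport_comp_subset (star_zero 𝕜) φ).trans φ.tsupport_subset

/-- Green's formula: the distributional Laplacian is represented by the Dirichlet form. -/
theorem inner_weakLaplacian {u w v : HalfLineL2 𝕜} (hw : HasWeakLaplacian u w)
    (huv : (u, v) ∈ closure (testPairs 𝕜)) {z : HalfLineL2 𝕜 × HalfLineL2 𝕜}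
    (hz : z ∈ closure (testPairs 𝕜)) : inner ℝ z.1 w = -inner ℝ z.2 v := by
  have hcl : IsClosed {z : HalfLineL2 𝕜 × HalfLineL2 𝕜 | inner ℝ z.1 w = -inner ℝ z.2 v} :=
    isClosed_eq (continuous_fst.inner continuous_const) (continuous_snd.inner continuous_const).neg
  refine closure_minimal ?_ hcl hz
  rintro ⟨z, z'⟩ ⟨φ, h1, h2⟩
  simp only [mem_ofPred_eq] at h1 h2 ⊢
  have hφ1 : ContDiff ℝ 1 (deriv φ) := by
    have h : ContDiff ℝ 2 φ := φ.contDiff.of_le (WithTop.coe_le_coe.2 (le_top : (2 : ℕ∞) ≤ ⊤))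
    exact ((contDiff_succ_iff_deriv (n := 1)).1 h).2.2
  have hmem : MemLp (deriv (deriv φ)) 2 halfLine :=
    (hφ1.continuous_deriv le_rfl).memLp_of_hasCompactSupport φ.hasCompactSupport.deriv.deriv
  -- With `z` reduced to a test function `φ`, `φ''` lies in `L₂`, so `(u, v)` can in turn be
  -- approximated by test pairs.
  have hA : ∀ p ∈ closure (testPairs 𝕜), inner ℝ (hmem.toLp _) p.1 = -inner ℝ z' p.2 := by
    intro p hp
    have hcl : IsClosed {p : HalfLineL2 𝕜 × HalfLineL2 𝕜 |
        inner ℝ (hmem.toLp _) p.1 = -inner ℝ z' p.2} :=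
      isClosed_eq (continuous_const.inner continuous_fst)
        (continuous_const.inner continuous_snd).neg
    refine closure_minimal ?_ hcl hp
    rintro ⟨p, p'⟩ ⟨χ, h3, h4⟩
    simp only [mem_ofPred_eq] at h3 h4 ⊢
    rw [L2.inner_def, L2.inner_def]
    have e1 : ∫ x, inner ℝ (hmem.toLp _ x) (p x) ∂halfLine
        = ∫ x, inner ℝ (deriv (deriv φ) x) (χ x) ∂halfLine := by
      refine integral_congr_ae ?_
      filter_upwards [hmem.coeFn_toLp, h3] with x h h'
      rw [h, h']
    have e2 : ∫ x, inner ℝ (z' x) (p' x) ∂halfLine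
        = ∫ x, inner ℝ (deriv φ x) (deriv χ x) ∂halfLine := by
      refine integral_congr_ae ?_
      filter_upwards [h2, h4] with x h h'
      rw [h, h']
    rw [e1, e2]
    exact integral_inner_deriv_eq_neg hφ1 (HalfLineTest.contDiff_one χ) χ.hasCompactSupport
      χ.tsupport_subset
  have hB : inner ℝ (hmem.toLp _) u = inner ℝ z w := by
    rw [inner_real_eq_re_inner, inner_real_eq_re_inner, L2.inner_def, L2.inner_def]
    congr 1
    -- The distributional pairing is bilinear and the inner product sesquilinear, hence the
    -- conjugate.
    have e := hw φ.conj
    have hd : deriv φ.conj = fun x => star (deriv φ x) := by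
      ext x; exact deriv.star
    have hdd : deriv (deriv φ.conj) = fun x => star (deriv (deriv φ) x) := by
      rw [hd]; ext x; exact deriv.star
    rw [hdd] at e
    calc _ = ∫ x in Ioi (0 : ℝ), u x * star (deriv (deriv φ) x) := by
          refine integral_congr_ae ?_
          filter_upwards [hmem.coeFn_toLp] with x h
          rw [h, RCLike.inner_apply]; rfl
      _ = ∫ x in Ioi (0 : ℝ), w x * φ.conj x := e
      _ = _ := by
          refine integral_congr_ae ?_
          filter_upwards [h1] with x h
          rw [h, RCLike.inner_apply]; rfl
  rw [← hB, hA _ huv]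

end HalfLine

/-! ### Convex functionals along orbits -/

section Convex

variable {H : Type*} [NormedAddCommGroup H] [InnerProductSpace ℝ H]

/-- The subgradient inequality in both orders gives `|F b - F a| ≤ (‖G a‖ + ‖G b‖) ‖b - a‖`. -/
theorem continuous_of_subgradient {F : H → ℝ} {G : H → H} (hG : Continuous G)
    (hF : ∀ a b, F b - F a ≤ inner ℝ (G b) (b - a)) : Continuous F := by
  rw [continuous_iff_continuousAt]
  intro a
  have h1 : Tendsto (fun b => (‖G b‖ + ‖G a‖) * ‖b - a‖) (𝓝 a) (𝓝 0) := by
    have : Continuous fun b => (‖G b‖ + ‖G a‖) * ‖b - a‖ := by fun_prop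
    simpa using this.tendsto a
  refine tendsto_iff_norm_sub_tendsto_zero.2 (squeeze_zero (fun b => norm_nonneg _) ?_ h1)
  intro b
  have h2 := (hF a b).trans (real_inner_le_norm _ _)
  have h3 := (hF b a).trans (real_inner_le_norm _ _)
  rw [norm_sub_rev] at h3
  have h4 : 0 ≤ ‖G b‖ * ‖b - a‖ := by positivity
  have h5 : 0 ≤ ‖G a‖ * ‖b - a‖ := by positivity
  rw [Real.norm_eq_abs, abs_le]
  constructor <;> nlinarith

/-- A one-sided chain rule without differentiability of `F`: take the subgradient at the later point
`u (s + r)`, then let `r → 0` using continuity of `G`. -/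
theorem exists_right_slope_le {F : H → ℝ} {G : H → H} (hG : Continuous G)
    (hF : ∀ a b, F b - F a ≤ inner ℝ (G b) (b - a)) {u : ℝ≥0 → H} (hu : Continuous u)
    {s : ℝ≥0} {u' : H}
    (hu' : Tendsto (fun r : ℝ≥0 => (r : ℝ)⁻¹ • (u (s + r) - u s)) (𝓝[>] 0) (𝓝 u')) :
    ∃ g : ℝ≥0 → ℝ, Tendsto g (𝓝[>] 0) (𝓝 (inner ℝ (G (u s)) u')) ∧
      ∀ r, 0 < r → F (u (s + r)) - F (u s) ≤ r * g r := by
  refine ⟨fun r => inner ℝ (G (u (s + r))) ((r : ℝ)⁻¹ • (u (s + r) - u s)), ?_, ?_⟩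
  · refine Tendsto.inner ?_ hu'
    have : Continuous fun r => G (u (s + r)) := by fun_prop
    exact (this.tendsto' 0 _ (by simp)).mono_left nhdsWithin_le_nhds
  · intro r hr
    have hr' : (r : ℝ) ≠ 0 := (NNReal.coe_pos.2 hr).ne'
    beta_reduce
    rw [real_inner_smul_right, mul_inv_cancel_left₀ hr']
    exact hF _ _

theorem norm_sq_sub_norm_sq_le (a b : H) : ‖b‖ ^ 2 - ‖a‖ ^ 2 ≤ inner ℝ ((2 : ℝ) • b) (b - a) := by
  have h := sq_nonneg ‖b - a‖
  rw [norm_sub_sq_real] at h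
  rw [real_inner_smul_left, inner_sub_right, real_inner_self_eq_norm_sq]
  linarith

/-- A Lyapunov functional: `c = 0` serves for contractivity, `c > 0` lets the dissipation of `q`
absorb the source terms in the equation of `p`. -/
theorem norm_sq_add_norm_sq_le {p q : ℝ≥0 → H} (hp : Continuous p) (hq : Continuous q) {c : ℝ}
    (hc : 0 ≤ c) (h : ∀ s, ∃ p' q' : H,
      Tendsto (fun r : ℝ≥0 => (r : ℝ)⁻¹ • (p (s + r) - p s)) (𝓝[>] 0) (𝓝 p') ∧
      Tendsto (fun r : ℝ≥0 => (r : ℝ)⁻¹ • (q (s + r) - q s)) (𝓝[>] 0) (𝓝 q') ∧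
      inner ℝ (p s) p' + c * inner ℝ (q s) q' ≤ 0) (t : ℝ≥0) :
    ‖p t‖ ^ 2 + c * ‖q t‖ ^ 2 ≤ ‖p 0‖ ^ 2 + c * ‖q 0‖ ^ 2 := by
  have key := le_add_mul_of_right_slope_le (φ := fun t => ‖p t‖ ^ 2 + c * ‖q t‖ ^ 2) (C := 0)
    (by fun_prop) (fun s => ?_) t
  · simpa using key
  · obtain ⟨p', q', hp', hq', hle⟩ := h s
    obtain ⟨g1, hg1, hle1⟩ := exists_right_slope_le (continuous_const_smul (2 : ℝ))
      norm_sq_sub_norm_sq_le hp hp'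
    obtain ⟨g2, hg2, hle2⟩ := exists_right_slope_le (continuous_const_smul (2 : ℝ))
      norm_sq_sub_norm_sq_le hq hq'
    refine ⟨_, ?_, _, hg1.add (hg2.const_mul c), fun r hr => ?_⟩
    · rw [real_inner_smul_left, real_inner_smul_left]
      linarith
    · have l1 := hle1 r hr
      have l2 := mul_le_mul_of_nonneg_left (hle2 r hr) hc
      linarith

end Convex

/-! ### Energy estimates and convergence of the truncated semigroups -/

section HalfLine

variable {𝕜 : Type*} [RCLike 𝕜] {T : ℝ≥0 → HalfLineL2 𝕜 →L[𝕜] HalfLineL2 𝕜}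

theorem isBoundedPerturbation_iff {W : ℝ → ℝ} {B : HalfLineL2 𝕜 →L[𝕜] HalfLineL2 𝕜}
    (hB : ∀ u, B u =ᵐ[halfLine] fun x => W x • u x)
    {S : ℝ≥0 → HalfLineL2 𝕜 →L[𝕜] HalfLineL2 𝕜} :
    IsBoundedPerturbation T W S ↔ IsC0Semigroup S ∧
      generatorGraph S = {q | (q.1, q.2 + B q.1) ∈ generatorGraph T} := by
  have hset : {q : HalfLineL2 𝕜 × HalfLineL2 𝕜 | ∃ w : HalfLineL2 𝕜, (q.1, w) ∈ generatorGraph T ∧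
      ∀ᵐ x ∂halfLine, q.2 x = w x - (W x : 𝕜) * q.1 x}
      = {q | (q.1, q.2 + B q.1) ∈ generatorGraph T} := by
    ext ⟨u, v⟩
    simp only [mem_ofPred_eq]
    constructor
    · rintro ⟨w, hw, h⟩
      have : w = v + B u := by
        refine Lp.ext ?_
        filter_upwards [h, hB u, Lp.coeFn_add v (B u)] with x h1 h2 h3
        rw [h3, Pi.add_apply, h1, h2, RCLike.real_smul_eq_coe_mul, sub_add_cancel]
      rwa [← this]
    · intro h
      refine ⟨_, h, ?_⟩
      filter_upwards [hB u, Lp.coeFn_add v (B u)] with x h2 h3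
      rw [h3, Pi.add_apply, h2, RCLike.real_smul_eq_coe_mul, add_sub_cancel_right]
  rw [IsBoundedPerturbation, hset]

/-- The Dirichlet form representation of the Dirichlet Laplacian. -/
theorem exists_form_of_mem_dirichletLaplacianGraph {u w : HalfLineL2 𝕜}
    (h : (u, w) ∈ dirichletLaplacianGraph 𝕜) :
    ∃ v, (u, v) ∈ closure (testPairs 𝕜) ∧
      ∀ z ∈ closure (testPairs 𝕜), inner ℝ z.1 w = -inner ℝ z.2 v := by
  obtain ⟨⟨v, hv⟩, hw⟩ := h
  exact ⟨v, hv, fun z hz => inner_weakLaplacian hw hv hz⟩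

/-- Dissipativity: `⟨u, Δu⟩ = -‖u'‖² ≤ 0` along orbits in the domain. -/
theorem norm_semigroup_le_one (hT : IsC0Semigroup T)
    (hgen : generatorGraph T = dirichletLaplacianGraph 𝕜) (t : ℝ≥0) : ‖T t‖ ≤ 1 := by
  refine ContinuousLinearMap.opNorm_le_bound _ zero_le_one fun f => ?_
  rw [one_mul]
  refine hT.dense_domain.induction (P := fun f => ‖T t f‖ ≤ ‖f‖) ?_
    (isClosed_le (by fun_prop) (by fun_prop)) f
  rintro f ⟨w, hw⟩
  have h := norm_sq_add_norm_sq_le (hT.continuous_orbit f) (hT.continuous_orbit f) le_rfl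
    (fun s => ?_) t
  · simp only [hT.apply_zero, zero_mul, add_zero] at h
    exact (pow_le_pow_iff_left₀ (norm_nonneg _) (norm_nonneg _) two_ne_zero).1 h
  · obtain ⟨h1, h2⟩ := hT.mem_generatorGraph_apply hw s
    refine ⟨_, _, h2, h2, ?_⟩
    rw [hgen] at h1
    obtain ⟨v, hv, hform⟩ := exists_form_of_mem_dirichletLaplacianGraph h1
    have h3 := hform _ hv
    simp only at h3
    rw [h3, real_inner_self_eq_norm_sq]
    nlinarith [sq_nonneg ‖v‖]

/-- With `X = ‖(a-b)'‖` and `Y = ‖b'‖`, the Hardy type bound gives `⟨a-b, a'-b'⟩ ≤ -(1-α)X² + εXY`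
and `⟨b, b'⟩ ≤ -(1-α)Y²`, where `a'`, `b'` denote the generators applied to `a`, `b`. The factor
`(ε/(2(1-α)))²` turns the sum into minus a square. -/
theorem inner_add_mul_inner_le_zero {α : ℝ} (hα : α < 1) {W₁ W₂ : ℝ → ℝ}
    {B₁ B₂ : HalfLineL2 𝕜 →L[𝕜] HalfLineL2 𝕜}
    (hB₁ : ∀ u, B₁ u =ᵐ[halfLine] fun x => W₁ x • u x)
    (hB₂ : ∀ u, B₂ u =ᵐ[halfLine] fun x => W₂ x • u x)
    (hi₁ : IntegrableOn (fun x => x * |W₁ x|) (Ioi 0))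
    (hi₂ : IntegrableOn (fun x => x * |W₂ x|) (Ioi 0))
    (hi : IntegrableOn (fun x => x * |W₁ x - W₂ x|) (Ioi 0))
    (hα₁ : ∫ x in Ioi (0 : ℝ), x * |W₁ x| ≤ α) (hα₂ : ∫ x in Ioi (0 : ℝ), x * |W₂ x| ≤ α)
    {ε : ℝ} (hε : ∫ x in Ioi (0 : ℝ), x * |W₁ x - W₂ x| = ε) {a a' b b' : HalfLineL2 𝕜}
    (ha : (a, a' + B₁ a) ∈ dirichletLaplacianGraph 𝕜)
    (hb : (b, b' + B₂ b) ∈ dirichletLaplacianGraph 𝕜) :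
    inner ℝ (a - b) (a' - b') + (ε / (2 * (1 - α))) ^ 2 * inner ℝ b b' ≤ 0 := by
  have hβ : 0 < 1 - α := sub_pos.2 hα
  have hB : ∀ u, (B₁ - B₂) u =ᵐ[halfLine] fun x => (W₁ x - W₂ x) • u x := fun u => by
    filter_upwards [hB₁ u, hB₂ u, Lp.coeFn_sub (B₁ u) (B₂ u)] with x h1 h2 h3
    rw [sub_apply, h3, Pi.sub_apply, h1, h2, sub_smul]
  obtain ⟨va, hva, fa⟩ := exists_form_of_mem_dirichletLaplacianGraph ha
  obtain ⟨vb, hvb, fb⟩ := exists_form_of_mem_dirichletLaplacianGraph hb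
  have hd : (a - b, va - vb) ∈ closure (testPairs 𝕜) := sub_mem_closure_testPairs hva hvb
  have e1 : inner ℝ (a - b) (a' + B₁ a) = -inner ℝ (va - vb) va := fa _ hd
  have e2 : inner ℝ (a - b) (b' + B₂ b) = -inner ℝ (va - vb) vb := fb _ hd
  have e3 : inner ℝ b (b' + B₂ b) = -inner ℝ vb vb := fb _ hvb
  have i1 := (abs_le.1 (abs_inner_mulOperator_le hB₁ hi₁ hd hd)).1
  have i2 := (abs_le.1 (abs_inner_mulOperator_le hB hi hvb hd)).1
  have i3 := (abs_le.1 (abs_inner_mulOperator_le hB₂ hi₂ hvb hvb)).1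
  rw [real_inner_comm] at i1 i2 i3
  rw [hε] at i2
  set X := ‖va - vb‖
  set Y := ‖vb‖
  have k1 : inner ℝ (a - b) (a' - b') = -X ^ 2 - inner ℝ (a - b) (B₁ (a - b))
      - inner ℝ (a - b) ((B₁ - B₂) b) := by
    have h1 : -X ^ 2 = inner ℝ (a - b) (a' + B₁ a) - inner ℝ (a - b) (b' + B₂ b) := by
      rw [e1, e2, ← real_inner_self_eq_norm_sq, inner_sub_right (va - vb)]
      ring
    have h2 : a' - b' = (a' + B₁ a) - (b' + B₂ b) - B₁ (a - b) - (B₁ - B₂) b := by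
      rw [sub_apply, map_sub]; abel
    rw [h1, h2, inner_sub_right, inner_sub_right, inner_sub_right]
  have k2 : inner ℝ b b' = -Y ^ 2 - inner ℝ b (B₂ b) := by
    rw [inner_add_right, real_inner_self_eq_norm_sq] at e3
    linarith
  have l1 : inner ℝ (a - b) (a' - b') ≤ -(1 - α) * X ^ 2 + ε * (Y * X) := by
    have : (∫ x in Ioi (0 : ℝ), x * |W₁ x|) * (X * X) ≤ α * (X * X) := by gcongr
    rw [k1]; linarith
  have l2 : inner ℝ b b' ≤ -(1 - α) * Y ^ 2 := by
    have : (∫ x in Ioi (0 : ℝ), x * |W₂ x|) * (Y * Y) ≤ α * (Y * Y) := by gcongr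
    rw [k2]; linarith
  calc inner ℝ (a - b) (a' - b') + (ε / (2 * (1 - α))) ^ 2 * inner ℝ b b'
      ≤ (-(1 - α) * X ^ 2 + ε * (Y * X)) + (ε / (2 * (1 - α))) ^ 2 * (-(1 - α) * Y ^ 2) := by
        gcongr
    _ = -(1 - α) * (X - ε / (2 * (1 - α)) * Y) ^ 2 := by
      field_simp; ring
    _ ≤ 0 := mul_nonpos_of_nonpos_of_nonneg (by linarith) (sq_nonneg _)

/-- The energy estimate comparing the semigroups of two bounded potentials. -/
theorem norm_perturbation_sub_le (hT : IsC0Semigroup T)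
    (hgen : generatorGraph T = dirichletLaplacianGraph 𝕜) {α : ℝ} (hα : α < 1)
    {W₁ W₂ : ℝ → ℝ} {B₁ B₂ : HalfLineL2 𝕜 →L[𝕜] HalfLineL2 𝕜}
    (hB₁ : ∀ u, B₁ u =ᵐ[halfLine] fun x => W₁ x • u x)
    (hB₂ : ∀ u, B₂ u =ᵐ[halfLine] fun x => W₂ x • u x)
    (hi₁ : IntegrableOn (fun x => x * |W₁ x|) (Ioi 0))
    (hi₂ : IntegrableOn (fun x => x * |W₂ x|) (Ioi 0))
    (hi : IntegrableOn (fun x => x * |W₁ x - W₂ x|) (Ioi 0))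
    (hα₁ : ∫ x in Ioi (0 : ℝ), x * |W₁ x| ≤ α) (hα₂ : ∫ x in Ioi (0 : ℝ), x * |W₂ x| ≤ α)
    {R₁ R₂ : ℝ≥0 → HalfLineL2 𝕜 →L[𝕜] HalfLineL2 𝕜}
    (hR₁ : IsBoundedPerturbation T W₁ R₁) (hR₂ : IsBoundedPerturbation T W₂ R₂) (t : ℝ≥0) :
    ‖R₁ t - R₂ t‖ ≤ (∫ x in Ioi (0 : ℝ), x * |W₁ x - W₂ x|) / (2 * (1 - α)) := by
  obtain ⟨ε, hε⟩ : ∃ ε, ∫ x in Ioi (0 : ℝ), x * |W₁ x - W₂ x| = ε := ⟨_, rfl⟩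
  have hβ : 0 < 1 - α := sub_pos.2 hα
  have hε0 : 0 ≤ ε := hε ▸ setIntegral_nonneg measurableSet_Ioi fun x hx =>
    mul_nonneg (le_of_lt hx) (abs_nonneg _)
  rw [hε]
  obtain ⟨hS₁, hg₁⟩ := (isBoundedPerturbation_iff hB₁).1 hR₁
  obtain ⟨hS₂, hg₂⟩ := (isBoundedPerturbation_iff hB₂).1 hR₂
  rw [hgen] at hg₁ hg₂
  have hdom : ∀ f ∈ {u | ∃ w, (u, w) ∈ generatorGraph T},
      ‖R₁ t f - R₂ t f‖ ≤ ε / (2 * (1 - α)) * ‖f‖ := by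
    rintro f ⟨w, hw⟩
    rw [hgen] at hw
    have hf₁ : (f, w - B₁ f) ∈ generatorGraph R₁ := by
      rw [hg₁, mem_ofPred_eq, sub_add_cancel]; exact hw
    have hf₂ : (f, w - B₂ f) ∈ generatorGraph R₂ := by
      rw [hg₂, mem_ofPred_eq, sub_add_cancel]; exact hw
    have h := norm_sq_add_norm_sq_le (p := fun t => R₁ t f - R₂ t f)
      ((hS₁.continuous_orbit f).sub (hS₂.continuous_orbit f)) (hS₂.continuous_orbit f)
      (sq_nonneg (ε / (2 * (1 - α)))) (fun s => ?_) t
    -- Both orbits start at `f`, so initially only the term with `R₂` is present.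
    · rw [hS₁.apply_zero, hS₂.apply_zero, sub_self, norm_zero] at h
      refine (pow_le_pow_iff_left₀ (norm_nonneg _) (by positivity) two_ne_zero).1 ?_
      rw [mul_pow]
      have : 0 ≤ (ε / (2 * (1 - α))) ^ 2 * ‖R₂ t f‖ ^ 2 := by positivity
      linarith
    · obtain ⟨ha, ha'⟩ := hS₁.mem_generatorGraph_apply hf₁ s
      obtain ⟨hb, hb'⟩ := hS₂.mem_generatorGraph_apply hf₂ s
      rw [hg₁] at ha
      rw [hg₂] at hb
      refine ⟨_, _, (ha'.sub hb').congr fun r => ?_, hb',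
        inner_add_mul_inner_le_zero hα hB₁ hB₂ hi₁ hi₂ hi hα₁ hα₂ hε ha hb⟩
      rw [← smul_sub, sub_sub_sub_comm]
  have hall : ∀ f, ‖R₁ t f - R₂ t f‖ ≤ ε / (2 * (1 - α)) * ‖f‖ := fun f =>
    hT.dense_domain.induction hdom
      (isClosed_le ((R₁ t).continuous.sub (R₂ t).continuous).norm (continuous_norm.const_mul _)) f
  exact ContinuousLinearMap.opNorm_le_bound _ (by positivity) hall

/-- Bounded potentials converging pointwise and dominated by a potential `V` with
`∫ x |V(x)| dx < 1` yield strongly convergent semigroups. -/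
theorem exists_isStrongLimitOfPerturbations (hT : IsC0Semigroup T)
    (hgen : generatorGraph T = dirichletLaplacianGraph 𝕜) {V : ℝ → ℝ}
    (hV : IntegrableOn (fun x => x * |V x|) (Ioi 0)) {α : ℝ} (hα : α < 1)
    (hVα : ∫ x in Ioi (0 : ℝ), x * |V x| ≤ α) {W : ℕ → ℝ → ℝ} {U : ℝ → ℝ}
    (hW : ∀ n, AEMeasurable (W n) halfLine) (hWn : ∀ n x, |W n x| ≤ n)
    (hWV : ∀ n x, |W n x| ≤ |V x|) (hWU : ∀ x, Tendsto (fun n => W n x) atTop (𝓝 (U x))) :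
    ∃ S, IsC0Semigroup S ∧ IsStrongLimitOfPerturbations T W S := by
  have hβ : 0 < 1 - α := sub_pos.2 hα
  have hUV : ∀ x, |U x| ≤ |V x| := fun x =>
    le_of_tendsto (hWU x).abs (Eventually.of_forall fun n => hWV n x)
  have hU : AEMeasurable U halfLine :=
    aemeasurable_of_tendsto_metrizable_ae atTop hW (Eventually.of_forall hWU)
  have hWi : ∀ n, IntegrableOn (fun x => x * |W n x|) (Ioi 0) := fun n => by
    refine Integrable.mono hV
      (aemeasurable_id.mul (hW n).abs).aestronglyMeasurable (Eventually.of_forall fun x => ?_)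
    simp only [norm_mul, Real.norm_eq_abs, abs_abs]
    exact mul_le_mul_of_nonneg_left (hWV n x) (abs_nonneg x)
  have hWα : ∀ n, ∫ x in Ioi (0 : ℝ), x * |W n x| ≤ α := fun n => by
    refine le_trans (setIntegral_mono_on (hWi n) hV measurableSet_Ioi fun x hx => ?_) hVα
    have : (0 : ℝ) < x := hx
    exact mul_le_mul_of_nonneg_left (hWV n x) this.le
  have hdi : ∀ (A A' : ℝ → ℝ), AEMeasurable A halfLine → AEMeasurable A' halfLine →
      (∀ x, |A x| ≤ |V x|) → (∀ x, |A' x| ≤ |V x|) →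
      IntegrableOn (fun x => x * |A x - A' x|) (Ioi 0) := fun A A' hA hA' h h' => by
    refine Integrable.mono (hV.const_mul 2)
      (aemeasurable_id.mul (hA.sub hA').abs).aestronglyMeasurable (Eventually.of_forall fun x => ?_)
    simp only [norm_mul, Real.norm_eq_abs, abs_abs, Nat.abs_ofNat]
    have h1 := abs_sub (A x) (A' x)
    nlinarith [abs_nonneg x, h x, h' x]
  choose B hB using fun n =>
    exists_mulOperator 𝕜 (hW n) (C := n) (Eventually.of_forall fun x => hWn n x)
  have hex : ∀ n, ∃ R, IsBoundedPerturbation T (W n) R := fun n => by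
    -- The potential is subtracted from the generator.
    obtain ⟨S, hS, hSg⟩ := hT.exists_perturbation (norm_semigroup_le_one hT hgen) (-B n)
    refine ⟨S, (isBoundedPerturbation_iff (hB n)).2 ⟨hS, ?_⟩⟩
    rw [hSg]
    simp
  choose R hR using hex
  have hRS : ∀ n, IsC0Semigroup (R n) := fun n => (hR n).1
  -- The possibly unbounded limit `U` has no semigroup yet; it enters only through the triangle
  -- inequality `|W n - W m| ≤ |W n - U| + |W m - U|`.
  set e : ℕ → ℝ := fun n => (∫ x in Ioi (0 : ℝ), x * |W n x - U x|) / (2 * (1 - α)) with he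
  have he0 : Tendsto e atTop (𝓝 0) := by
    have h0 : Tendsto (fun n => ∫ x in Ioi (0 : ℝ), x * |W n x - U x|) atTop
        (𝓝 (∫ x in Ioi (0 : ℝ), 0)) := by
      refine tendsto_integral_of_dominated_convergence (fun x => x * (2 * |V x|))
        (fun n => (hdi _ _ (hW n) hU (hWV n) hUV).aestronglyMeasurable) ?_ (fun n => ?_) ?_
      · exact (hV.const_mul 2).congr (Eventually.of_forall fun x => by ring)
      · filter_upwards [ae_restrict_mem measurableSet_Ioi] with x hx
        have hx : 0 < x := hx
        rw [norm_mul, Real.norm_of_nonneg hx.le, Real.norm_eq_abs, abs_abs]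
        have h1 := abs_sub (W n x) (U x)
        gcongr
        linarith [hWV n x, hUV x]
      · refine Eventually.of_forall fun x => ?_
        have := ((hWU x).sub_const (U x)).abs.const_mul x
        simpa using this
    simpa [he] using h0.div_const (2 * (1 - α))
  have hRR : ∀ n m t, ‖R n t - R m t‖ ≤ e n + e m := fun n m t => by
    refine (norm_perturbation_sub_le hT hgen hα (hB n) (hB m) (hWi n) (hWi m)
      (hdi _ _ (hW n) (hW m) (hWV n) (hWV m)) (hWα n) (hWα m) (hR n) (hR m) t).trans ?_
    change _ ≤ _ / _ + _ / _
    rw [← add_div, ← integral_add (hdi _ _ (hW n) hU (hWV n) hUV) (hdi _ _ (hW m) hU (hWV m) hUV)]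
    gcongr ?_ / _
    refine setIntegral_mono_on (hdi _ _ (hW n) (hW m) (hWV n) (hWV m))
      ((hdi _ _ (hW n) hU (hWV n) hUV).add (hdi _ _ (hW m) hU (hWV m) hUV)) measurableSet_Ioi
      fun x hx => ?_
    have hx : 0 < x := hx
    rw [← mul_add, abs_sub_comm (W m x)]
    gcongr
    exact abs_sub_le _ _ _
  have hcau : ∀ t, ∃ S, Tendsto (fun n => R n t) atTop (𝓝 S) := fun t => by
    refine cauchySeq_tendsto_of_complete (Metric.cauchySeq_iff.2 fun δ hδ => ?_)
    obtain ⟨N, hN⟩ := eventually_atTop.1 (he0.eventually (gt_mem_nhds (half_pos hδ)))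
    refine ⟨N, fun n hn m hm => ?_⟩
    rw [dist_eq_norm]
    linarith [hRR n m t, hN n hn, hN m hm]
  choose S hS using hcau
  have hRSn : ∀ n t, ‖R n t - S t‖ ≤ e n := fun n t => by
    have h1 := (tendsto_const_nhds (x := R n t)).sub (hS t) |>.norm
    have h2 := (tendsto_const_nhds (x := e n)).add he0
    rw [add_zero] at h2
    exact le_of_tendsto_of_tendsto' h1 h2 fun m => hRR n m t
  refine ⟨S, ⟨?_, ?_, ?_⟩, R, hR, ?_⟩
  · refine tendsto_nhds_unique (hS 0) ?_
    simp only [(hRS _).map_zero, tendsto_const_nhds]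
  · intro s t
    refine tendsto_nhds_unique (hS (s + t)) ?_
    simp only [(hRS _).map_add]
    exact ((ContinuousLinearMap.compL 𝕜 _ _ _).continuous₂.tendsto (S s, S t)).comp
      ((hS s).prodMk_nhds (hS t))
  · intro f
    rw [Metric.tendsto_nhds]
    intro δ hδ
    have h1 : Tendsto (fun n => e n * ‖f‖) atTop (𝓝 0) := by simpa using he0.mul_const ‖f‖
    obtain ⟨n, hn⟩ := (h1.eventually (gt_mem_nhds (half_pos hδ))).exists
    filter_upwards [Metric.tendsto_nhds.1 ((hRS n).tendsto_zero f) _ (half_pos hδ)] with t ht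
    -- This bound is uniform in `t`, so strong continuity at `0` passes to the limit.
    have h2 : dist (S t f) (R n t f) ≤ e n * ‖f‖ := by
      rw [dist_comm, dist_eq_norm, ← sub_apply]
      exact ContinuousLinearMap.le_of_opNorm_le _ (hRSn n t) f
    linarith [dist_triangle (S t f) (R n t f) f]
  · intro t f
    exact ((ContinuousLinearMap.apply 𝕜 _ f).continuous.tendsto (S t)).comp (hS t)

end HalfLine

/-! ### The weight -/

/-- Fubini on `{x < y}`. For the weight it is used with `p` the indicator of `(0, x]`, giving `ω(x)
= ∫ k(y) min(x, y) dy`, and with `p = Q'`, giving `∫ κ Q' = ∫ k Q`. -/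
theorem integral_tail_mul {k p : ℝ → ℝ} (hk : IntegrableOn k (Ioi 0)) (hp : IntegrableOn p (Ioi 0)) :
    ∫ x in Ioi (0 : ℝ), (∫ y in Ioi x, k y) * p x =
      ∫ y in Ioi (0 : ℝ), k y * ∫ x in Ioo 0 y, p x := by
  have hms : MeasurableSet {z : ℝ × ℝ | z.1 < z.2} := measurableSet_lt measurable_fst measurable_snd
  have hint : Integrable (Function.uncurry fun x y : ℝ =>
      {z : ℝ × ℝ | z.1 < z.2}.indicator (fun z => p z.1 * k z.2) (x, y))
      (halfLine.prod halfLine) :=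
    (Integrable.mul_prod hp hk).indicator hms
  have hswap := integral_integral_swap hint
  calc ∫ x in Ioi (0 : ℝ), (∫ y in Ioi x, k y) * p x
      = ∫ x in Ioi (0 : ℝ), ∫ y in Ioi (0 : ℝ),
          {z : ℝ × ℝ | z.1 < z.2}.indicator (fun z => p z.1 * k z.2) (x, y) := by
        refine setIntegral_congr_fun measurableSet_Ioi fun x hx => ?_
        have : ∀ y, {z : ℝ × ℝ | z.1 < z.2}.indicator (fun z => p z.1 * k z.2) (x, y)
            = (Ioi x).indicator (fun y => p x * k y) y := fun y => rfl
        simp only [this]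
        rw [setIntegral_indicator measurableSet_Ioi, inter_eq_right.2 (Ioi_subset_Ioi (le_of_lt hx)),
          integral_const_mul, mul_comm]
    _ = ∫ y in Ioi (0 : ℝ), ∫ x in Ioi (0 : ℝ),
          {z : ℝ × ℝ | z.1 < z.2}.indicator (fun z => p z.1 * k z.2) (x, y) := hswap
    _ = _ := by
        refine setIntegral_congr_fun measurableSet_Ioi fun y hy => ?_
        have : ∀ x, {z : ℝ × ℝ | z.1 < z.2}.indicator (fun z => p z.1 * k z.2) (x, y)
            = (Iio y).indicator (fun x => p x * k y) x := fun x => rfl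
        simp only [this]
        rw [setIntegral_indicator measurableSet_Iio, Ioi_inter_Iio, integral_mul_const, mul_comm]

/-- A bounded `C¹` weight `ω`, comparable to `x` near the origin, with `-ω'' ≥ |W| ω` in the weak
sense. -/
theorem exists_weight {W : ℝ → ℝ} (hW : AEMeasurable W halfLine)
    (hWi : IntegrableOn (fun x => x * |W x|) (Ioi 0)) {α : ℝ} (hα : α < 1)
    (hWα : ∫ x in Ioi (0 : ℝ), x * |W x| ≤ α) {L : ℝ} (hL : 0 < L) :
    ∃ ω κ : ℝ → ℝ, (∀ x, HasDerivAt ω (κ x) x) ∧ Continuous κ ∧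
      (∀ x, 0 < x → x * (L - x) / L ≤ ω x ∧ 0 ≤ ω x ∧ ω x ≤ (1 - α)⁻¹ * x ∧
        ω x ≤ (1 - α)⁻¹ * L ∧ 0 ≤ κ x ∧ κ x ≤ (1 - α)⁻¹) ∧
      ∀ Q : ℝ → ℝ, ContDiff ℝ 1 Q → HasCompactSupport Q → tsupport Q ⊆ Ioi 0 → (∀ x, 0 ≤ Q x) →
        ∫ x in Ioi (0 : ℝ), |W x| * ω x * Q x ≤ ∫ x in Ioi (0 : ℝ), κ x * deriv Q x := by
  have hβ : 0 < 1 - α := sub_pos.2 hα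
  set c := (1 - α)⁻¹ with hc
  have hc0 : 0 < c := inv_pos.2 hβ
  have hcα : 1 + c * α = c := by rw [hc]; field_simp; ring
  set b : ℝ → ℝ := fun y => (Ioc 0 L).indicator (fun _ => L⁻¹) y with hb
  have hbi : Integrable b := (integrable_indicator_iff measurableSet_Ioc).2
    (integrableOn_const measure_Ioc_lt_top.ne)
  have hb0 : ∀ y, 0 ≤ b y := fun y => indicator_nonneg (fun _ _ => by positivity) y
  have hbint : ∫ y in Ioi (0 : ℝ), b y = 1 := by
    rw [setIntegral_indicator measurableSet_Ioc, inter_eq_right.2 Ioc_subset_Ioi_self,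
      setIntegral_const, Real.volume_real_Ioc_of_le hL.le, sub_zero, smul_eq_mul,
      mul_inv_cancel₀ hL.ne']
  -- `ω` will solve `-ω'' = k`. The source `c |W| min(y, L)` anticipates the bound `ω ≤ c min(y,
  -- L)`, so no fixed point is needed; `b` has mass one and provides the lower bound. The constant
  -- closes the argument because `1 + c α = c`.
  set k : ℝ → ℝ := fun y => b y + c * (|W y| * min y L) with hk
  set K : ℝ → ℝ := fun y => b y + c * (y * |W y|) with hK
  have hKi : IntegrableOn K (Ioi 0) := hbi.integrableOn.add (hWi.const_mul c)
  have hKint : ∫ y in Ioi (0 : ℝ), K y ≤ c := by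
    rw [hK, integral_add hbi.integrableOn (hWi.const_mul c), hbint, integral_const_mul]
    nlinarith
  have hk0 : ∀ y, 0 < y → 0 ≤ k y := fun y hy =>
    add_nonneg (hb0 y) (mul_nonneg hc0.le (mul_nonneg (abs_nonneg _) (le_min hy.le hL.le)))
  have hkK : ∀ y, 0 < y → k y ≤ K y := fun y hy => by
    simp only [hk, hK, mul_comm y]
    gcongr
    exact min_le_left _ _
  have hki : IntegrableOn k (Ioi 0) := by
    refine Integrable.mono' hKi ?_ ?_
    · exact (hbi.aestronglyMeasurable.restrict.aemeasurable.add
        ((hW.abs.mul (aemeasurable_id.min aemeasurable_const)).const_mul c)).aestronglyMeasurable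
    · filter_upwards [ae_restrict_mem measurableSet_Ioi] with y hy
      rw [Real.norm_of_nonneg (hk0 y hy)]
      exact hkK y hy
  have hki' : Integrable ((Ioi 0).indicator k) := (integrable_indicator_iff measurableSet_Ioi).2 hki
  -- The tail integral of `k`, written so that it is continuous on all of `ℝ`.
  set κ : ℝ → ℝ := fun x => (∫ y, (Ioi 0).indicator k y) - ∫ y in (0 : ℝ)..x, (Ioi 0).indicator k y
    with hκ
  have hκc : Continuous κ := continuous_const.sub
    (intervalIntegral.continuous_primitive (fun a b => hki'.intervalIntegrable) 0)
  have hκtail : ∀ x, 0 ≤ x → κ x = ∫ y in Ioi x, k y := fun x hx => by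
    have h1 : ∫ y in (0 : ℝ)..x, (Ioi 0).indicator k y = ∫ y in Ioc 0 x, k y := by
      rw [intervalIntegral.integral_of_le hx]
      exact setIntegral_congr_fun measurableSet_Ioc fun y hy => indicator_of_mem hy.1 _
    have h2 : ∫ y in Ioi (0 : ℝ), k y = (∫ y in Ioc 0 x, k y) + ∫ y in Ioi x, k y := by
      rw [← Ioc_union_Ioi_eq_Ioi hx]
      exact setIntegral_union (Ioc_disjoint_Ioi le_rfl) measurableSet_Ioi
        (hki.mono_set Ioc_subset_Ioi_self) (hki.mono_set (Ioi_subset_Ioi hx))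
    simp only [hκ]
    rw [h1, integral_indicator measurableSet_Ioi, h2, add_sub_cancel_left]
  have hκ0 : ∀ x, 0 ≤ x → 0 ≤ κ x := fun x hx => by
    rw [hκtail x hx]
    exact setIntegral_nonneg measurableSet_Ioi fun y hy => hk0 y (hx.trans_lt hy)
  have hκ1 : ∀ x, 0 ≤ x → κ x ≤ c := fun x hx => by
    rw [hκtail x hx]
    calc ∫ y in Ioi x, k y ≤ ∫ y in Ioi (0 : ℝ), k y :=
          setIntegral_mono_set hki ((ae_restrict_mem measurableSet_Ioi).mono fun y hy => hk0 y hy)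
            (Ioi_subset_Ioi hx).eventuallyLE
      _ ≤ ∫ y in Ioi (0 : ℝ), K y :=
          setIntegral_mono_on hki hKi measurableSet_Ioi fun y hy => hkK y hy
      _ ≤ c := hKint
  set ω : ℝ → ℝ := fun x => ∫ y in (0 : ℝ)..x, κ y with hω
  have hωd : ∀ x, HasDerivAt ω (κ x) x := fun x =>
    intervalIntegral.integral_hasDerivAt_right (hκc.intervalIntegrable _ _)
      (hκc.stronglyMeasurableAtFilter _ _) hκc.continuousAt
  have hωk : ∀ x, 0 < x → ω x = ∫ y in Ioi (0 : ℝ), k y * min x y := fun x hx => by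
    have h1 := integral_tail_mul hki (p := (Ioc 0 x).indicator fun _ => 1)
      ((integrable_indicator_iff measurableSet_Ioc).2
        (integrableOn_const measure_Ioc_lt_top.ne)).integrableOn
    have h2 : ω x = ∫ z in Ioi (0 : ℝ), (∫ y in Ioi z, k y) * (Ioc 0 x).indicator (fun _ => 1) z := by
      have : ∀ z, (∫ y in Ioi z, k y) * (Ioc 0 x).indicator (fun _ => (1 : ℝ)) z
          = (Ioc 0 x).indicator (fun z => ∫ y in Ioi z, k y) z := fun z => by
        by_cases hz : z ∈ Ioc 0 x <;> simp [hz]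
      simp only [this]
      rw [setIntegral_indicator measurableSet_Ioc, inter_eq_right.2 Ioc_subset_Ioi_self, hω]
      beta_reduce
      rw [intervalIntegral.integral_of_le hx.le]
      exact setIntegral_congr_fun measurableSet_Ioc fun z hz => hκtail z hz.1.le
    rw [h2, h1]
    refine setIntegral_congr_fun measurableSet_Ioi fun y hy => ?_
    have hy : 0 < y := hy
    have h3 : ∫ z in Ioo 0 y, (Ioc 0 x).indicator (fun _ => (1 : ℝ)) z = min x y := by
      rw [← integral_Ioc_eq_integral_Ioo, setIntegral_indicator measurableSet_Ioc,
        Ioc_inter_Ioc, max_self, setIntegral_const, Real.volume_real_Ioc_of_le (le_min hy.le hx.le),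
        sub_zero, smul_eq_mul, mul_one, min_comm]
    simp only [h3]
  have hkmi : ∀ x, 0 < x → IntegrableOn (fun y => k y * min x y) (Ioi 0) := fun x hx => by
    refine Integrable.mono' (hki.mul_const x)
      (hki.aestronglyMeasurable.mul (measurable_const.min measurable_id).aestronglyMeasurable) ?_
    filter_upwards [ae_restrict_mem measurableSet_Ioi] with y hy
    have hy : 0 < y := hy
    rw [norm_mul, Real.norm_of_nonneg (hk0 y hy), Real.norm_of_nonneg (le_min hx.le hy.le)]
    exact mul_le_mul_of_nonneg_left (min_le_left _ _) (hk0 y hy)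
  have hωup : ∀ x, 0 < x → ω x ≤ c * min x L := fun x hx => by
    have hm : 0 < min x L := lt_min hx hL
    calc ω x = ∫ y in Ioi (0 : ℝ), k y * min x y := hωk x hx
      _ ≤ ∫ y in Ioi (0 : ℝ), K y * min x L := by
          refine setIntegral_mono_on (hkmi x hx) (hKi.mul_const _) measurableSet_Ioi fun y hy => ?_
          have hy : 0 < y := hy
          simp only [hk, hK, add_mul]
          have h1 : b y * min x y ≤ b y * min x L := by
            by_cases h : y ∈ Ioc 0 L
            · exact mul_le_mul_of_nonneg_left (min_le_min_left _ h.2) (hb0 y)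
            · simp [hb, h]
          -- This replaces `k(y) min(x, y)` by `K(y) min(x, L)`, and `∫ K ≤ 1 + c α = c`.
          have h2 : min y L * min x y ≤ y * min x L := by
            rcases le_total x L with h | h
            · rw [min_eq_left h]
              exact mul_le_mul (min_le_left _ _) (min_le_left _ _) (le_min hx.le hy.le) hy.le
            · rw [min_eq_right h, mul_comm]
              exact mul_le_mul (min_le_right _ _) (min_le_right _ _) (le_min hy.le hL.le) hy.le
          have h3 : c * (|W y| * min y L) * min x y ≤ c * (y * |W y|) * min x L := by
            calc c * (|W y| * min y L) * min x y = c * |W y| * (min y L * min x y) := by ring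
              _ ≤ c * |W y| * (y * min x L) := by gcongr
              _ = _ := by ring
          linarith
      _ = (∫ y in Ioi (0 : ℝ), K y) * min x L := integral_mul_const _ _
      _ ≤ c * min x L := by gcongr
  have hω0 : ∀ x, 0 < x → 0 ≤ ω x := fun x hx =>
    intervalIntegral.integral_nonneg hx.le fun y hy => hκ0 y hy.1
  have hωlow : ∀ x, 0 < x → x * (L - x) / L ≤ ω x := fun x hx => by
    rcases le_total x L with h | h
    -- The lower bound keeps only the part `b` of the source on `(x, L]`, where `min x y = x`.
    · have e : x * (L - x) / L
          = ∫ y in Ioi (0 : ℝ), (Ioc x L).indicator (fun _ => L⁻¹ * x) y := by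
        rw [setIntegral_indicator measurableSet_Ioc,
          inter_eq_right.2 (Ioc_subset_Ioi_self.trans (Ioi_subset_Ioi hx.le)), setIntegral_const,
          Real.volume_real_Ioc_of_le h, smul_eq_mul]
        field_simp
      rw [e, hωk x hx]
      refine setIntegral_mono_on ((integrable_indicator_iff measurableSet_Ioc).2
        (integrableOn_const measure_Ioc_lt_top.ne)).integrableOn (hkmi x hx) measurableSet_Ioi
        fun y hy => ?_
      have hy : 0 < y := hy
      by_cases hyx : y ∈ Ioc x L
      · rw [indicator_of_mem hyx, min_eq_left hyx.1.le]
        gcongr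
        have hby : b y = L⁻¹ := indicator_of_mem (s := Ioc 0 L) ⟨hy, hyx.2⟩ _
        simp only [hk, hby]
        exact le_add_of_nonneg_right
          (mul_nonneg hc0.le (mul_nonneg (abs_nonneg _) (le_min hy.le hL.le)))
      · rw [indicator_of_notMem hyx]
        exact mul_nonneg (hk0 y hy) (le_min hx.le hy.le)
    · refine le_trans ?_ (hω0 x hx)
      exact div_nonpos_of_nonpos_of_nonneg (mul_nonpos_of_nonneg_of_nonpos hx.le (by linarith)) hL.le
  refine ⟨ω, κ, hωd, hκc, fun x hx => ⟨hωlow x hx, hω0 x hx, (hωup x hx).trans ?_,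
    (hωup x hx).trans ?_, hκ0 x hx.le, hκ1 x hx.le⟩, ?_⟩
  · gcongr; exact min_le_left _ _
  · gcongr; exact min_le_right _ _
  · intro Q hQ hQc hQs hQ0
    have hQd : Continuous (deriv Q) := hQ.continuous_deriv le_rfl
    have hQ00 : Q 0 = 0 := image_eq_zero_of_notMem_tsupport fun h => lt_irrefl (0 : ℝ) (mem_Ioi.1 (hQs h))
    have h1 := integral_tail_mul hki (hQd.integrable_of_hasCompactSupport hQc.deriv).integrableOn
    have h2 : ∫ x in Ioi (0 : ℝ), κ x * deriv Q x
        = ∫ x in Ioi (0 : ℝ), (∫ y in Ioi x, k y) * deriv Q x :=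
      setIntegral_congr_fun measurableSet_Ioi fun x hx => by rw [hκtail x (le_of_lt hx)]
    have h3 : ∫ y in Ioi (0 : ℝ), (k y * ∫ x in Ioo 0 y, deriv Q x)
        = ∫ y in Ioi (0 : ℝ), k y * Q y := by
      refine setIntegral_congr_fun measurableSet_Ioi fun y hy => ?_
      rw [← integral_Ioc_eq_integral_Ioo, ← intervalIntegral.integral_of_le (le_of_lt hy),
        intervalIntegral.integral_deriv_eq_sub (fun y _ => hQ.differentiable one_ne_zero y)
          (hQd.intervalIntegrable _ _), hQ00, sub_zero]
    rw [h2, h1, h3]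
    -- The supersolution property: `|W| ω ≤ c |W| min(y, L) ≤ k = -ω''`.
    have hle : ∀ y, 0 < y → |W y| * ω y * Q y ≤ k y * Q y := fun y hy => by
      refine mul_le_mul_of_nonneg_right ?_ (hQ0 y)
      calc |W y| * ω y ≤ |W y| * (c * min y L) := by gcongr; exact hωup y hy
        _ = c * (|W y| * min y L) := by ring
        _ ≤ k y := le_add_of_nonneg_left (hb0 y)
    obtain ⟨M, hM⟩ := hQc.exists_bound_of_continuous hQ.continuous
    have hkQ : IntegrableOn (fun y => k y * Q y) (Ioi 0) :=
      Integrable.mul_bdd hki hQ.continuous.aestronglyMeasurable (Eventually.of_forall hM)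
    have hωc : Continuous ω := continuous_iff_continuousAt.2 fun x => (hωd x).continuousAt
    refine setIntegral_mono_on (Integrable.mono' hkQ ?_ ?_) hkQ measurableSet_Ioi hle
    · exact ((hW.abs.mul hωc.aemeasurable).mul hQ.continuous.aemeasurable).aestronglyMeasurable
    · filter_upwards [ae_restrict_mem measurableSet_Ioi] with y hy
      rw [Real.norm_of_nonneg (mul_nonneg (mul_nonneg (abs_nonneg _) (hω0 y hy)) (hQ0 y))]
      exact hle y hy

/-! ### A smooth approximation of the norm -/

section SmoothNorm

variable {H : Type*} [NormedAddCommGroup H] {ε : ℝ}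

/-- `√(‖z‖² + ε²) - ε`, a smooth convex approximation of the norm. -/
def smoothNorm (ε : ℝ) (z : H) : ℝ := √(‖z‖ ^ 2 + ε ^ 2) - ε

theorem sqrt_norm_sq_add_pos (hε : 0 < ε) (z : H) : 0 < √(‖z‖ ^ 2 + ε ^ 2) :=
  Real.sqrt_pos.2 (by positivity)

theorem sq_sqrt_norm_sq_add (z : H) : √(‖z‖ ^ 2 + ε ^ 2) ^ 2 = ‖z‖ ^ 2 + ε ^ 2 :=
  Real.sq_sqrt (by positivity)

theorem le_sqrt_norm_sq_add (z : H) : ε ≤ √(‖z‖ ^ 2 + ε ^ 2) :=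
  Real.le_sqrt_of_sq_le (by nlinarith [sq_nonneg ‖z‖])

theorem norm_le_sqrt_norm_sq_add (z : H) : ‖z‖ ≤ √(‖z‖ ^ 2 + ε ^ 2) :=
  Real.le_sqrt_of_sq_le (by nlinarith [sq_nonneg ε])

theorem smoothNorm_nonneg (z : H) : 0 ≤ smoothNorm ε z :=
  sub_nonneg.2 (le_sqrt_norm_sq_add z)

theorem smoothNorm_zero (hε : 0 < ε) : smoothNorm ε (0 : H) = 0 := by
  simp [smoothNorm, Real.sqrt_sq hε.le]

theorem smoothNorm_le_norm (hε : 0 < ε) (z : H) : smoothNorm ε z ≤ ‖z‖ := by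
  rw [smoothNorm, sub_le_iff_le_add, Real.sqrt_le_left (by positivity)]
  nlinarith [mul_nonneg (norm_nonneg z) hε.le]

/-- The quadratic bound makes the weighted functional finite on `L₂` for any bounded weight, despite
the infinite measure. -/
theorem smoothNorm_le_norm_sq (hε : 0 < ε) (z : H) : smoothNorm ε z ≤ (2 * ε)⁻¹ * ‖z‖ ^ 2 := by
  rw [smoothNorm, sub_le_iff_le_add, Real.sqrt_le_left (by positivity)]
  have h : ((2 * ε)⁻¹ * ‖z‖ ^ 2 + ε) ^ 2 = ((2 * ε)⁻¹ * ‖z‖ ^ 2) ^ 2 + ‖z‖ ^ 2 + ε ^ 2 := by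
    field_simp; ring
  rw [h]
  nlinarith [sq_nonneg ((2 * ε)⁻¹ * ‖z‖ ^ 2)]

variable [InnerProductSpace ℝ H]

/-- The gradient of `smoothNorm`. -/
def smoothSign (ε : ℝ) (z : H) : H := (√(‖z‖ ^ 2 + ε ^ 2))⁻¹ • z

/-- Convexity, from the Cauchy–Schwarz inequality for `(b, ε)` and `(a, ε)` in `H ⊕ ℝ`. -/
theorem smoothNorm_sub_le (hε : 0 < ε) (a b : H) :
    smoothNorm ε b - smoothNorm ε a ≤ inner ℝ (smoothSign ε b) (b - a) := by
  have hs := sqrt_norm_sq_add_pos hε b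
  have hr := sqrt_norm_sq_add_pos hε a
  have hs2 := sq_sqrt_norm_sq_add (ε := ε) b
  have hr2 := sq_sqrt_norm_sq_add (ε := ε) a
  rw [smoothSign, real_inner_smul_left, inner_sub_right, real_inner_self_eq_norm_sq,
    inv_mul_eq_div, le_div_iff₀ hs, smoothNorm, smoothNorm]
  set s := √(‖b‖ ^ 2 + ε ^ 2)
  set r := √(‖a‖ ^ 2 + ε ^ 2)
  have h1 := real_inner_le_norm b a
  have h2 : ‖b‖ * ‖a‖ + ε ^ 2 ≤ s * r := by
    refine (pow_le_pow_iff_left₀ (by positivity) (by positivity) two_ne_zero).1 ?_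
    rw [mul_pow, hs2, hr2]
    nlinarith [sq_nonneg (ε * (‖b‖ - ‖a‖))]
  nlinarith

/-- For the norm itself this difference vanishes; its bound `ε` is the source of the error term in
the evolution estimate. -/
theorem inner_smoothSign_self_sub_le (hε : 0 < ε) (z : H) :
    inner ℝ (smoothSign ε z) z - smoothNorm ε z ≤ ε := by
  have hs := sqrt_norm_sq_add_pos hε z
  have hs2 := sq_sqrt_norm_sq_add (ε := ε) z
  rw [smoothSign, real_inner_smul_left, real_inner_self_eq_norm_sq, smoothNorm]
  have : (√(‖z‖ ^ 2 + ε ^ 2))⁻¹ * ‖z‖ ^ 2 ≤ √(‖z‖ ^ 2 + ε ^ 2) := by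
    rw [inv_mul_le_iff₀ hs]
    nlinarith [sq_nonneg ε]
  linarith

theorem inner_smoothSign_self_nonneg (z : H) : 0 ≤ inner ℝ (smoothSign ε z) z := by
  rw [smoothSign, real_inner_smul_left, real_inner_self_eq_norm_sq]
  positivity

theorem norm_smoothSign_le (hε : 0 < ε) (z : H) : ‖smoothSign ε z‖ ≤ ε⁻¹ * ‖z‖ := by
  have hs := sqrt_norm_sq_add_pos hε z
  rw [smoothSign, norm_smul, norm_inv, Real.norm_of_nonneg hs.le]
  gcongr
  exact le_sqrt_norm_sq_add z

theorem smoothSign_zero : smoothSign ε (0 : H) = 0 := by simp [smoothSign]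

/-- Lets the gradient act as a continuous map on `L₂` by composition; the constant need not be
sharp. -/
theorem lipschitzWith_smoothSign (hε : 0 < ε) :
    LipschitzWith (2 * ε⁻¹).toNNReal (smoothSign ε : H → H) := by
  refine LipschitzWith.of_dist_le_mul fun a b => ?_
  rw [Real.coe_toNNReal _ (by positivity), dist_eq_norm, dist_eq_norm]
  have hs := sqrt_norm_sq_add_pos hε a
  have hr := sqrt_norm_sq_add_pos hε b
  have hs2 := sq_sqrt_norm_sq_add (ε := ε) a
  have hr2 := sq_sqrt_norm_sq_add (ε := ε) b
  have hεs := le_sqrt_norm_sq_add (ε := ε) a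
  have hbr := norm_le_sqrt_norm_sq_add (ε := ε) b
  have has := norm_le_sqrt_norm_sq_add (ε := ε) a
  simp only [smoothSign]
  set s := √(‖a‖ ^ 2 + ε ^ 2)
  set r := √(‖b‖ ^ 2 + ε ^ 2)
  have hrs : |r - s| ≤ ‖a - b‖ := by
    have h1 : |r - s| * (r + s) ≤ ‖a - b‖ * (r + s) := by
      have e1 : |r - s| * (r + s) = |‖b‖ - ‖a‖| * (‖b‖ + ‖a‖) := by
        have h2 : (r - s) * (r + s) = (‖b‖ - ‖a‖) * (‖b‖ + ‖a‖) := by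
          linear_combination hr2 - hs2
        have h3 := congrArg abs h2
        rwa [abs_mul, abs_mul, abs_of_pos (add_pos hr hs),
          abs_of_nonneg (add_nonneg (norm_nonneg b) (norm_nonneg a))] at h3
      rw [e1]
      have e2 : |‖b‖ - ‖a‖| ≤ ‖a - b‖ := by
        rw [abs_sub_comm]; exact abs_norm_sub_norm_le a b
      gcongr
    exact le_of_mul_le_mul_right h1 (add_pos hr hs)
  have hsplit : s⁻¹ • a - r⁻¹ • b = s⁻¹ • (a - b) + (s⁻¹ * r⁻¹ * (r - s)) • b := by
    rw [smul_sub, sub_add, ← sub_smul]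
    congr 2
    field_simp
    ring
  rw [hsplit]
  calc ‖s⁻¹ • (a - b) + (s⁻¹ * r⁻¹ * (r - s)) • b‖
      ≤ s⁻¹ * ‖a - b‖ + s⁻¹ * (r⁻¹ * ‖b‖) * |r - s| := by
        refine (norm_add_le _ _).trans_eq ?_
        rw [norm_smul, norm_smul, norm_mul, norm_mul, norm_inv, norm_inv,
          Real.norm_of_nonneg hs.le, Real.norm_of_nonneg hr.le, Real.norm_eq_abs]
        ring
    _ ≤ s⁻¹ * ‖a - b‖ + s⁻¹ * 1 * ‖a - b‖ := by
        gcongr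
        rw [inv_mul_le_iff₀ hr]; simpa using hbr
    _ = 2 * s⁻¹ * ‖a - b‖ := by ring
    _ ≤ 2 * ε⁻¹ * ‖a - b‖ := by gcongr

theorem contDiff_sqrt_norm_sq_add (hε : 0 < ε) :
    ContDiff ℝ 1 fun z : H => √(‖z‖ ^ 2 + ε ^ 2) :=
  ((contDiff_norm_sq ℝ).add contDiff_const).sqrt fun z => by positivity

theorem contDiff_smoothNorm (hε : 0 < ε) : ContDiff ℝ 1 (smoothNorm ε : H → ℝ) :=
  (contDiff_sqrt_norm_sq_add hε).sub contDiff_const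

theorem contDiff_smoothSign (hε : 0 < ε) : ContDiff ℝ 1 (smoothSign ε : H → H) :=
  ((contDiff_sqrt_norm_sq_add hε).inv fun z => (sqrt_norm_sq_add_pos hε z).ne').smul contDiff_id

theorem hasDerivAt_sqrt_norm_sq_add (hε : 0 < ε) {φ : ℝ → H} {φ' : H} {x : ℝ}
    (h : HasDerivAt φ φ' x) :
    HasDerivAt (fun x => √(‖φ x‖ ^ 2 + ε ^ 2)) (inner ℝ (smoothSign ε (φ x)) φ') x := by
  have hs := sqrt_norm_sq_add_pos hε (φ x)
  refine ((h.norm_sq.add_const (ε ^ 2)).sqrt (by positivity)).congr_deriv ?_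
  rw [smoothSign, real_inner_smul_left]
  field_simp

theorem hasDerivAt_smoothNorm (hε : 0 < ε) {φ : ℝ → H} {φ' : H} {x : ℝ} (h : HasDerivAt φ φ' x) :
    HasDerivAt (fun x => smoothNorm ε (φ x)) (inner ℝ (smoothSign ε (φ x)) φ') x :=
  (hasDerivAt_sqrt_norm_sq_add hε h).sub_const ε

/-- The sign condition is positivity of the Hessian of `smoothNorm`, by Cauchy–Schwarz; the norm
bound is the Lipschitz constant of its gradient. -/
theorem exists_hasDerivAt_smoothSign (hε : 0 < ε) {φ : ℝ → H} {φ' : H} {x : ℝ}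
    (h : HasDerivAt φ φ' x) :
    ∃ d, HasDerivAt (fun x => smoothSign ε (φ x)) d x ∧ 0 ≤ inner ℝ d φ' ∧
      ‖d‖ ≤ 2 * ε⁻¹ * ‖φ'‖ := by
  have hs := sqrt_norm_sq_add_pos hε (φ x)
  have hs2 := sq_sqrt_norm_sq_add (ε := ε) (φ x)
  have hd := ((hasDerivAt_sqrt_norm_sq_add hε h).inv hs.ne').smul h
  refine ⟨_, hd, ?_, ?_⟩
  · set s := √(‖φ x‖ ^ 2 + ε ^ 2)
    rw [inner_add_left, real_inner_smul_left, real_inner_smul_left, real_inner_self_eq_norm_sq,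
      smoothSign, real_inner_smul_left]
    change 0 ≤ s⁻¹ * ‖φ'‖ ^ 2 + -(s⁻¹ * inner ℝ (φ x) φ') / s ^ 2 * inner ℝ (φ x) φ'
    have e : s⁻¹ * ‖φ'‖ ^ 2 + -(s⁻¹ * inner ℝ (φ x) φ') / s ^ 2 * inner ℝ (φ x) φ'
        = s⁻¹ * (s ^ 2)⁻¹ * (s ^ 2 * ‖φ'‖ ^ 2 - (inner ℝ (φ x) φ') ^ 2) := by
      field_simp
      ring
    rw [e]
    refine mul_nonneg (by positivity) (sub_nonneg.2 ?_)
    have h1 := abs_real_inner_le_norm (φ x) φ'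
    have h2 : (inner ℝ (φ x) φ') ^ 2 ≤ (‖φ x‖ * ‖φ'‖) ^ 2 := by
      rw [← sq_abs]; gcongr
    rw [hs2]
    nlinarith [sq_nonneg (ε * ‖φ'‖)]
  · have hl : LipschitzWith (2 * ε⁻¹).toNNReal (smoothSign ε : H → H) := lipschitzWith_smoothSign hε
    have hF : HasFDerivAt (smoothSign ε : H → H) (fderiv ℝ (smoothSign ε) (φ x)) (φ x) :=
      ((contDiff_smoothSign hε).differentiable one_ne_zero _).hasFDerivAt
    have h3 := (hF.comp_hasDerivAt x h).unique hd
    rw [← h3]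
    refine (ContinuousLinearMap.le_opNorm _ _).trans ?_
    gcongr
    have := norm_fderiv_le_of_lipschitz ℝ hl (x₀ := φ x)
    rwa [Real.coe_toNNReal _ (by positivity)] at this

end SmoothNorm

/-! ### The regularised weighted `L₁` functional -/

section HalfLine

variable {𝕜 : Type*} [RCLike 𝕜] {ε : ℝ}

/-- The functional `u ↦ ∫ ρ (√(|u|² + ε²) - ε)`. -/
def weightedSmoothNorm (ε : ℝ) (ρ : ℝ → ℝ) (u : HalfLineL2 𝕜) : ℝ :=
  ∫ x in Ioi (0 : ℝ), ρ x * smoothNorm ε (u x)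

theorem integrable_mul_smoothNorm (hε : 0 < ε) {ρ : ℝ → ℝ} (hρ : AEMeasurable ρ halfLine) {C : ℝ}
    (hC : ∀ᵐ x ∂halfLine, |ρ x| ≤ C) (u : HalfLineL2 𝕜) :
    Integrable (fun x => ρ x * smoothNorm ε (u x)) halfLine := by
  have h1 : Integrable (fun x => C * ((2 * ε)⁻¹ * inner ℝ (u x) (u x))) halfLine :=
    ((L2.integrable_inner (𝕜 := ℝ) u u).const_mul _).const_mul _
  refine Integrable.mono' h1 (hρ.aestronglyMeasurable.mul
    ((contDiff_smoothNorm hε).continuous.comp_aestronglyMeasurable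
      (Lp.aestronglyMeasurable u))) ?_
  filter_upwards [hC] with x hx
  rw [norm_mul, Real.norm_eq_abs, Real.norm_of_nonneg (smoothNorm_nonneg _),
    real_inner_self_eq_norm_sq]
  exact mul_le_mul hx (smoothNorm_le_norm_sq hε _) (smoothNorm_nonneg _)
    ((abs_nonneg _).trans hx)

/-- `weightedSmoothNorm` is convex with a continuous gradient. -/
theorem exists_gradient_weightedSmoothNorm (hε : 0 < ε) {ρ : ℝ → ℝ} (hρ : AEMeasurable ρ halfLine)
    {C : ℝ} (hC : ∀ᵐ x ∂halfLine, |ρ x| ≤ C) (hρ0 : ∀ᵐ x ∂halfLine, 0 ≤ ρ x) :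
    ∃ G : HalfLineL2 𝕜 → HalfLineL2 𝕜, Continuous G ∧
      (∀ u, G u =ᵐ[halfLine] fun x => ρ x • smoothSign ε (u x)) ∧
      ∀ a b, weightedSmoothNorm ε ρ b - weightedSmoothNorm ε ρ a ≤ inner ℝ (G b) (b - a) := by
  obtain ⟨B, hB⟩ := exists_mulOperator 𝕜 hρ hC
  have hl : LipschitzWith (2 * ε⁻¹).toNNReal (smoothSign ε : 𝕜 → 𝕜) := lipschitzWith_smoothSign hε
  have hc : ∀ u : HalfLineL2 𝕜, hl.compLp smoothSign_zero u =ᵐ[halfLine] smoothSign ε ∘ u :=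
    fun u => hl.coeFn_compLp smoothSign_zero u
  refine ⟨fun u => B (hl.compLp smoothSign_zero u),
    B.continuous.comp (hl.continuous_compLp smoothSign_zero), fun u => ?_, fun a b => ?_⟩
  · filter_upwards [hB (hl.compLp smoothSign_zero u), hc u] with x h1 h2
    rw [h1, h2]; rfl
  · rw [weightedSmoothNorm, weightedSmoothNorm,
      ← integral_sub (integrable_mul_smoothNorm hε hρ hC b) (integrable_mul_smoothNorm hε hρ hC a),
      L2.inner_def]
    refine integral_mono_ae ((integrable_mul_smoothNorm hε hρ hC b).sub
      (integrable_mul_smoothNorm hε hρ hC a)) (L2.integrable_inner _ _) ?_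
    filter_upwards [hB (hl.compLp smoothSign_zero b), hc b, hρ0, Lp.coeFn_sub b a]
      with x h1 h2 h3 h4
    rw [h1, h2, h4, ← mul_sub, real_inner_smul_left]
    exact mul_le_mul_of_nonneg_left (smoothNorm_sub_le hε _ _) h3

end HalfLine

/-! ### Kato's inequality with weight -/

section HalfLine

variable {𝕜 : Type*} [RCLike 𝕜] {ε : ℝ}

set_option maxHeartbeats 1000000 in
-- The derivative of `ω smoothSign(φ)` is `κ smoothSign(φ) + ω d`, with `d` the derivative of
-- `smoothSign(φ)`. Against `φ'` the first part gives `∫ κ (smoothNorm φ)'`, bounded below by the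
-- property of the weight; the second is nonnegative by convexity. The bound on `‖z‖` serves the
-- passage to the closure.
theorem exists_weighted_testFunction (hε : 0 < ε) {W ω κ : ℝ → ℝ} {c M : ℝ}
    (hωd : ∀ x, HasDerivAt ω (κ x) x) (hκc : Continuous κ)
    (hω : ∀ x, 0 < x → 0 ≤ ω x ∧ ω x ≤ M ∧ 0 ≤ κ x ∧ κ x ≤ c)
    (hker : ∀ Q : ℝ → ℝ, ContDiff ℝ 1 Q → HasCompactSupport Q → tsupport Q ⊆ Ioi 0 →
      (∀ x, 0 ≤ Q x) →
        ∫ x in Ioi (0 : ℝ), |W x| * ω x * Q x ≤ ∫ x in Ioi (0 : ℝ), κ x * deriv Q x)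
    {G : HalfLineL2 𝕜 → HalfLineL2 𝕜}
    (hG : ∀ u, G u =ᵐ[halfLine] fun x => ω x • smoothSign ε (u x))
    {p : HalfLineL2 𝕜 × HalfLineL2 𝕜} (hp : p ∈ testPairs 𝕜) :
    ∃ z, (G p.1, z) ∈ closure (testPairs 𝕜) ∧
      ‖z‖ ≤ c * ε⁻¹ * ‖p.1‖ + M * (2 * ε⁻¹) * ‖p.2‖ ∧
      weightedSmoothNorm ε (fun x => |W x| * ω x) p.1 ≤ inner ℝ z p.2 := by
  obtain ⟨φ, h1, h2⟩ := hp
  have hφ1 := HalfLineTest.contDiff_one φ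
  have hφd : ∀ x, HasDerivAt φ (deriv φ x) x := fun x =>
    (hφ1.differentiable one_ne_zero x).hasDerivAt
  have hωc : Continuous ω := continuous_iff_continuousAt.2 fun x => (hωd x).continuousAt
  have hω1 : ContDiff ℝ 1 ω := contDiff_one_iff_deriv.2
    ⟨fun x => (hωd x).differentiableAt, by rwa [funext fun x => (hωd x).deriv]⟩
  choose d hd hd0 hdn using fun x => exists_hasDerivAt_smoothSign hε (hφd x)
  have hs1 : ContDiff ℝ 1 fun x => smoothSign ε (φ x) := (contDiff_smoothSign hε).comp hφ1
  have hsc : HasCompactSupport fun x => smoothSign ε (φ x) :=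
    φ.hasCompactSupport.comp_left smoothSign_zero
  have hdd : deriv (fun x => smoothSign ε (φ x)) = d := funext fun x => (hd x).deriv
  have hdc : Continuous d := hdd ▸ hs1.continuous_deriv le_rfl
  have hdcs : HasCompactSupport d := hdd ▸ hsc.deriv
  have hts : tsupport (fun x => smoothSign ε (φ x)) ⊆ Ioi 0 :=
    (tsupport_comp_subset smoothSign_zero φ).trans φ.tsupport_subset
  obtain ⟨g, hg⟩ : ∃ g : ℝ → 𝕜, g = fun x => ω x • smoothSign ε (φ x) := ⟨_, rfl⟩
  have hg1 : ContDiff ℝ 1 g := hg ▸ hω1.smul hs1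
  have hgd : ∀ x, deriv g x = κ x • smoothSign ε (φ x) + ω x • d x := fun x => by
    have h : HasDerivAt g (ω x • d x + κ x • smoothSign ε (φ x)) x := hg ▸ (hωd x).smul (hd x)
    rw [h.deriv, add_comm]
  have hgsupp : Function.support g ⊆ Function.support fun x => smoothSign ε (φ x) :=
    fun x hx h => hx ((congrFun hg x).trans ((congrArg (ω x • ·) h).trans (smul_zero _)))
  have hgc : HasCompactSupport g := hsc.mono hgsupp
  have hgs : tsupport g ⊆ Ioi 0 := (closure_mono hgsupp).trans hts
  have hm1 : MemLp (fun x => κ x • smoothSign ε (φ x)) 2 halfLine :=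
    (hκc.smul hs1.continuous).memLp_of_hasCompactSupport
      (hsc.mono fun x hx h => hx ((congrArg (κ x • ·) h).trans (smul_zero _)))
  have hm2 : MemLp (fun x => ω x • d x) 2 halfLine :=
    (hωc.smul hdc).memLp_of_hasCompactSupport
      (hdcs.mono fun x hx h => hx ((congrArg (ω x • ·) h).trans (smul_zero _)))
  obtain ⟨z₁, hz₁⟩ : ∃ z₁ : HalfLineL2 𝕜, z₁ =ᵐ[halfLine] fun x => κ x • smoothSign ε (φ x) :=
    ⟨hm1.toLp _, hm1.coeFn_toLp⟩
  obtain ⟨z₂, hz₂⟩ : ∃ z₂ : HalfLineL2 𝕜, z₂ =ᵐ[halfLine] fun x => ω x • d x :=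
    ⟨hm2.toLp _, hm2.coeFn_toLp⟩
  have a₁ : ∀ᵐ x ∂halfLine, ‖z₁ x‖ ≤ c * ε⁻¹ * ‖p.1 x‖ := by
    filter_upwards [hz₁, h1, ae_restrict_mem measurableSet_Ioi] with x e1 e2 hx
    obtain ⟨-, -, hx0, hxc⟩ := hω x hx
    rw [e1, e2, norm_smul, Real.norm_of_nonneg hx0, mul_assoc]
    exact mul_le_mul hxc (norm_smoothSign_le hε _) (norm_nonneg _) (hx0.trans hxc)
  have a₂ : ∀ᵐ x ∂halfLine, ‖z₂ x‖ ≤ M * (2 * ε⁻¹) * ‖p.2 x‖ := by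
    filter_upwards [hz₂, h2, ae_restrict_mem measurableSet_Ioi] with x e1 e2 hx
    obtain ⟨hx0, hxM, -, -⟩ := hω x hx
    rw [e1, e2, norm_smul, Real.norm_of_nonneg hx0, mul_assoc]
    exact mul_le_mul hxM (hdn x) (norm_nonneg _) (hx0.trans hxM)
  have n₁ : ‖z₁‖ ≤ c * ε⁻¹ * ‖p.1‖ := Lp.norm_le_mul_norm_of_ae_le_mul a₁
  have n₂ : ‖z₂‖ ≤ M * (2 * ε⁻¹) * ‖p.2‖ := Lp.norm_le_mul_norm_of_ae_le_mul a₂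
  have b₁ : G p.1 =ᵐ[halfLine] g := by
    filter_upwards [hG p.1, h1] with x h h'
    rw [h, h', hg]
  have b₂ : (z₁ + z₂ : HalfLineL2 𝕜) =ᵐ[halfLine] deriv g := by
    filter_upwards [hz₁, hz₂, Lp.coeFn_add z₁ z₂] with x e1 e2 e3
    rw [e3, Pi.add_apply, e1, e2, hgd]
  have hmem : (G p.1, z₁ + z₂) ∈ closure (testPairs 𝕜) :=
    mem_closure_testPairs_of_contDiff hg1 hgc hgs b₁ b₂
  refine ⟨z₁ + z₂, hmem, ?_, ?_⟩
  · exact (norm_add_le z₁ z₂).trans (add_le_add n₁ n₂)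
  · have hQ1 : ContDiff ℝ 1 fun x => smoothNorm ε (φ x) := (contDiff_smoothNorm hε).comp hφ1
    have hQc : HasCompactSupport fun x => smoothNorm ε (φ x) :=
      φ.hasCompactSupport.comp_left (smoothNorm_zero hε)
    have hQs : tsupport (fun x => smoothNorm ε (φ x)) ⊆ Ioi 0 :=
      (tsupport_comp_subset (smoothNorm_zero hε) φ).trans φ.tsupport_subset
    have hk := hker _ hQ1 hQc hQs fun x => smoothNorm_nonneg _
    have e1 : weightedSmoothNorm ε (fun x => |W x| * ω x) p.1
        = ∫ x in Ioi (0 : ℝ), |W x| * ω x * smoothNorm ε (φ x) :=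
      integral_congr_ae (h1.mono fun x hx => by simp only [hx])
    have e2 : inner ℝ z₁ p.2
        = ∫ x in Ioi (0 : ℝ), κ x * deriv (fun x => smoothNorm ε (φ x)) x := by
      rw [L2.inner_def]
      refine integral_congr_ae ?_
      filter_upwards [hz₁, h2] with x h h'
      rw [h, h', real_inner_smul_left, (hasDerivAt_smoothNorm hε (hφd x)).deriv]
    have e3 : 0 ≤ inner ℝ z₂ p.2 := by
      rw [L2.inner_def]
      refine integral_nonneg_of_ae ?_
      filter_upwards [hz₂, h2, ae_restrict_mem measurableSet_Ioi] with x h h' hx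
      rw [h, h', real_inner_smul_left]
      exact mul_nonneg (hω x hx).1 (hd0 x)
    rw [e1, inner_add_left, e2]
    linarith

/-- A Kato type inequality for the Dirichlet Laplacian. -/
theorem inner_gradient_weakLaplacian_le (hε : 0 < ε) {W ω κ : ℝ → ℝ} {c M N : ℝ}
    (hW : AEMeasurable W halfLine) (hN : ∀ x, |W x| ≤ N)
    (hωd : ∀ x, HasDerivAt ω (κ x) x) (hκc : Continuous κ)
    (hω : ∀ x, 0 < x → 0 ≤ ω x ∧ ω x ≤ M ∧ 0 ≤ κ x ∧ κ x ≤ c)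
    (hker : ∀ Q : ℝ → ℝ, ContDiff ℝ 1 Q → HasCompactSupport Q → tsupport Q ⊆ Ioi 0 →
      (∀ x, 0 ≤ Q x) →
        ∫ x in Ioi (0 : ℝ), |W x| * ω x * Q x ≤ ∫ x in Ioi (0 : ℝ), κ x * deriv Q x)
    {G : HalfLineL2 𝕜 → HalfLineL2 𝕜} (hGc : Continuous G)
    (hG : ∀ u, G u =ᵐ[halfLine] fun x => ω x • smoothSign ε (u x))
    {u w : HalfLineL2 𝕜} (huw : (u, w) ∈ dirichletLaplacianGraph 𝕜) :
    inner ℝ (G u) w ≤ -weightedSmoothNorm ε (fun x => |W x| * ω x) u := by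
  obtain ⟨v, hv, hform⟩ := exists_form_of_mem_dirichletLaplacianGraph huw
  have hωc : Continuous ω := continuous_iff_continuousAt.2 fun x => (hωd x).continuousAt
  have hN0 : 0 ≤ N := (abs_nonneg _).trans (hN 0)
  have hbd : ∀ᵐ x ∂halfLine, |(|W x| * ω x)| ≤ N * M :=
    (ae_restrict_mem measurableSet_Ioi).mono fun x hx => by
      rw [abs_mul, abs_abs, abs_of_nonneg (hω x hx).1]
      exact mul_le_mul (hN x) (hω x hx).2.1 (hω x hx).1 hN0
  have hnn : ∀ᵐ x ∂halfLine, 0 ≤ |W x| * ω x :=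
    (ae_restrict_mem measurableSet_Ioi).mono fun x hx => mul_nonneg (abs_nonneg _) (hω x hx).1
  obtain ⟨G', hG'c, -, hG'⟩ := exists_gradient_weightedSmoothNorm (𝕜 := 𝕜) hε
    (hW.abs.mul hωc.aemeasurable) hbd hnn
  have hΨ : Continuous fun u : HalfLineL2 𝕜 => weightedSmoothNorm ε (fun x => |W x| * ω x) u :=
    continuous_of_subgradient hG'c hG'
  -- For a test pair `p` the form pairs `z` with `v` instead of `p.2`. The resulting error is kept
  -- in the closed condition and vanishes at `p = (u, v)`, so `G u` need not be differentiated for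
  -- general `u`.
  have hcl : IsClosed {p : HalfLineL2 𝕜 × HalfLineL2 𝕜 |
      inner ℝ (G p.1) w ≤ -weightedSmoothNorm ε (fun x => |W x| * ω x) p.1
        + (c * ε⁻¹ * ‖p.1‖ + M * (2 * ε⁻¹) * ‖p.2‖) * ‖v - p.2‖} := by
    refine isClosed_le ((hGc.comp continuous_fst).inner continuous_const) ?_
    exact (hΨ.comp continuous_fst).neg.add (by fun_prop)
  have hmem := closure_minimal (fun p hp => ?_) hcl hv
  · rw [mem_ofPred_eq, sub_self, norm_zero, mul_zero, add_zero] at hmem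
    exact hmem
  · obtain ⟨z, hz, hzn, hzΨ⟩ := exists_weighted_testFunction hε hωd hκc hω hker hG hp
    have h1 : inner ℝ (G p.1) w = -inner ℝ z v := hform _ hz
    have h2 : inner ℝ z v = inner ℝ z p.2 + inner ℝ z (v - p.2) := by
      rw [← inner_add_right, add_sub_cancel]
    have h3 := (abs_le.1 (abs_real_inner_le_norm z (v - p.2))).1
    have h4 : ‖z‖ * ‖v - p.2‖ ≤ (c * ε⁻¹ * ‖p.1‖ + M * (2 * ε⁻¹) * ‖p.2‖) * ‖v - p.2‖ := by
      gcongr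
    simp only [mem_ofPred_eq]
    rw [h1, h2]
    linarith

/-- The potential contributes at most `∫ |W| ω ⟨smoothSign u, u⟩`, and Kato's inequality supplies
`-∫ |W| ω smoothNorm u`. They cancel up to `ε ∫ |W| ω ≤ ε c ∫ x|W|`, whatever the sign of `W`. -/
theorem inner_gradient_sub_le (hε : 0 < ε) {W ω κ : ℝ → ℝ} {α c M N : ℝ}
    (hW : AEMeasurable W halfLine) (hN : ∀ x, |W x| ≤ N)
    (hWi : IntegrableOn (fun x => x * |W x|) (Ioi 0))
    (hWα : ∫ x in Ioi (0 : ℝ), x * |W x| ≤ α) (hc : 0 ≤ c)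
    (hωd : ∀ x, HasDerivAt ω (κ x) x) (hκc : Continuous κ)
    (hω : ∀ x, 0 < x → 0 ≤ ω x ∧ ω x ≤ M ∧ 0 ≤ κ x ∧ κ x ≤ c) (hωc : ∀ x, 0 < x → ω x ≤ c * x)
    (hker : ∀ Q : ℝ → ℝ, ContDiff ℝ 1 Q → HasCompactSupport Q → tsupport Q ⊆ Ioi 0 →
      (∀ x, 0 ≤ Q x) →
        ∫ x in Ioi (0 : ℝ), |W x| * ω x * Q x ≤ ∫ x in Ioi (0 : ℝ), κ x * deriv Q x)
    {B : HalfLineL2 𝕜 →L[𝕜] HalfLineL2 𝕜} (hB : ∀ u, B u =ᵐ[halfLine] fun x => W x • u x)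
    {G : HalfLineL2 𝕜 → HalfLineL2 𝕜} (hGc : Continuous G)
    (hG : ∀ u, G u =ᵐ[halfLine] fun x => ω x • smoothSign ε (u x))
    {u w : HalfLineL2 𝕜} (huw : (u, w) ∈ dirichletLaplacianGraph 𝕜) :
    inner ℝ (G u) (w - B u) ≤ ε * (c * α) := by
  have h1 := inner_gradient_weakLaplacian_le hε hW hN hωd hκc hω hker hGc hG huw
  have hωcont : Continuous ω := continuous_iff_continuousAt.2 fun x => (hωd x).continuousAt
  have hbd : ∀ᵐ x ∂halfLine, |(|W x| * ω x)| ≤ N * M :=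
    (ae_restrict_mem measurableSet_Ioi).mono fun x hx => by
      rw [abs_mul, abs_abs, abs_of_nonneg (hω x hx).1]
      exact mul_le_mul (hN x) (hω x hx).2.1 (hω x hx).1 ((abs_nonneg _).trans (hN 0))
  have hi : Integrable (fun x => |W x| * ω x * smoothNorm ε (u x)) halfLine :=
    integrable_mul_smoothNorm (𝕜 := 𝕜) hε (hW.abs.mul hωcont.aemeasurable) hbd u
  have h2 : -weightedSmoothNorm ε (fun x => |W x| * ω x) u - inner ℝ (G u) (B u)
      ≤ ∫ x in Ioi (0 : ℝ), ε * (c * (x * |W x|)) := by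
    have hi' : Integrable (fun x => -(|W x| * ω x * smoothNorm ε (u x))) halfLine := hi.neg
    rw [weightedSmoothNorm, L2.inner_def, ← integral_neg,
      ← integral_sub hi' (L2.integrable_inner _ _)]
    refine integral_mono_ae (hi'.sub (L2.integrable_inner _ _))
      ((hWi.const_mul c).const_mul ε) ?_
    filter_upwards [hG u, hB u, ae_restrict_mem measurableSet_Ioi] with x e1 e2 hx
    have hx0 : 0 < x := hx
    rw [e1, e2, real_inner_smul_left, real_inner_smul_right]
    have k1 := inner_smoothSign_self_sub_le hε (u x)
    have k2 := inner_smoothSign_self_nonneg (ε := ε) (u x)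
    have k3 := (hω x hx).1
    have k4 : -(ω x * (W x * inner ℝ (smoothSign ε (u x)) (u x)))
        ≤ |W x| * ω x * inner ℝ (smoothSign ε (u x)) (u x) := by
      have : -W x ≤ |W x| := neg_le_abs _
      have := mul_le_mul_of_nonneg_right this (mul_nonneg k3 k2)
      linarith
    have k5 : |W x| * ω x * (inner ℝ (smoothSign ε (u x)) (u x) - smoothNorm ε (u x))
        ≤ |W x| * (c * x) * ε := by
      refine (mul_le_mul_of_nonneg_left k1 (mul_nonneg (abs_nonneg _) k3)).trans ?_
      have := hωc x hx
      gcongr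
    linarith
  rw [integral_const_mul, integral_const_mul] at h2
  rw [inner_sub_right]
  have h3 : ε * (c * ∫ x in Ioi (0 : ℝ), x * |W x|) ≤ ε * (c * α) := by gcongr
  linarith

end HalfLine

/-! ### The weighted `L₁` bound for bounded potentials -/

section HalfLine

variable {𝕜 : Type*} [RCLike 𝕜] {T R : ℝ≥0 → HalfLineL2 𝕜 →L[𝕜] HalfLineL2 𝕜}

/-- Along orbits in the domain the functional has right slope at most `ε c α` with `c = (1-α)⁻¹`;
density and continuity give all `f`. -/
theorem exists_weightedSmoothNorm_perturbation_le (hgen : generatorGraph T = dirichletLaplacianGraph 𝕜) {α : ℝ} (hα : α < 1)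
    {W : ℝ → ℝ} {N : ℝ} (hW : AEMeasurable W halfLine) (hN : ∀ x, |W x| ≤ N)
    (hWi : IntegrableOn (fun x => x * |W x|) (Ioi 0)) (hWα : ∫ x in Ioi (0 : ℝ), x * |W x| ≤ α)
    (hR : IsBoundedPerturbation T W R) {ε L : ℝ} (hε : 0 < ε) (hL : 0 < L) (t : ℝ≥0) :
    ∃ (ω : ℝ → ℝ) (C : ℝ), AEMeasurable ω halfLine ∧
      (∀ x, 0 < x → x * (L - x) / L ≤ ω x ∧ |ω x| ≤ C ∧ 0 ≤ ω x ∧ ω x ≤ (1 - α)⁻¹ * x) ∧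
      ∀ f, weightedSmoothNorm ε ω (R t f)
        ≤ weightedSmoothNorm ε ω f + ε * ((1 - α)⁻¹ * α) * t := by
  obtain ⟨ω, κ, hωd, hκc, hω, hker⟩ := exists_weight hW hWi hα hWα hL
  have hωc : Continuous ω := continuous_iff_continuousAt.2 fun x => (hωd x).continuousAt
  have hbd : ∀ x, 0 < x → |ω x| ≤ (1 - α)⁻¹ * L := fun x hx =>
    (abs_of_nonneg (hω x hx).2.1).trans_le (hω x hx).2.2.2.1
  refine ⟨ω, (1 - α)⁻¹ * L, hωc.aemeasurable,
    fun x hx => ⟨(hω x hx).1, hbd x hx, (hω x hx).2.1, (hω x hx).2.2.1⟩, ?_⟩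
  obtain ⟨G, hGc, hG, hsub⟩ := exists_gradient_weightedSmoothNorm (𝕜 := 𝕜) hε hωc.aemeasurable
    ((ae_restrict_mem measurableSet_Ioi).mono hbd)
    ((ae_restrict_mem measurableSet_Ioi).mono fun x hx => (hω x hx).2.1)
  have hF : Continuous (weightedSmoothNorm ε ω : HalfLineL2 𝕜 → ℝ) :=
    continuous_of_subgradient hGc hsub
  obtain ⟨B, hB⟩ := exists_mulOperator 𝕜 hW (Eventually.of_forall hN)
  obtain ⟨hS, hg⟩ := (isBoundedPerturbation_iff hB).1 hR
  rw [hgen] at hg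
  have hdom : ∀ f ∈ {u | ∃ w, (u, w) ∈ generatorGraph R},
      weightedSmoothNorm ε ω (R t f) ≤ weightedSmoothNorm ε ω f + ε * ((1 - α)⁻¹ * α) * t := by
    rintro f ⟨w, hw⟩
    have h := le_add_mul_of_right_slope_le (φ := fun t => weightedSmoothNorm ε ω (R t f))
      (hF.comp (hS.continuous_orbit f)) (C := ε * ((1 - α)⁻¹ * α)) (fun s => ?_) t
    · rwa [hS.apply_zero] at h
    · obtain ⟨h1, h2⟩ := hS.mem_generatorGraph_apply hw s
      obtain ⟨g, hg1, hg2⟩ := exists_right_slope_le hGc hsub (hS.continuous_orbit f) h2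
      refine ⟨_, ?_, g, hg1, hg2⟩
      rw [hg, mem_ofPred_eq] at h1
      have h3 := inner_gradient_sub_le hε hW hN hWi hWα (inv_nonneg.2 (sub_pos.2 hα).le) hωd hκc
        (fun x hx => (hω x hx).2.imp_right fun h => h.2) (fun x hx => (hω x hx).2.2.1) hker hB
        hGc hG h1
      rwa [add_sub_cancel_right] at h3
  intro f
  exact hS.dense_domain.induction hdom
    (isClosed_le (hF.comp (R t).continuous) (hF.add continuous_const)) f

theorem ofReal_weightedSmoothNorm {ε : ℝ} (hε : 0 < ε) {ω : ℝ → ℝ} {C : ℝ}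
    (hω : AEMeasurable ω halfLine) (hC : ∀ x, 0 < x → |ω x| ≤ C) (h0 : ∀ x, 0 < x → 0 ≤ ω x)
    (u : HalfLineL2 𝕜) :
    ENNReal.ofReal (weightedSmoothNorm ε ω u)
      = ∫⁻ x in Ioi (0 : ℝ), ENNReal.ofReal (ω x * smoothNorm ε (u x)) :=
  ofReal_integral_eq_lintegral_ofReal
    (integrable_mul_smoothNorm hε hω ((ae_restrict_mem measurableSet_Ioi).mono hC) u)
    ((ae_restrict_mem measurableSet_Ioi).mono fun x hx => mul_nonneg (h0 x hx) (smoothNorm_nonneg _))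

/-- Replaces `ω` by its explicit bounds on each side; extended nonnegative integrals allow `∫ x|f| =
∞`. -/
theorem lintegral_smoothNorm_perturbation_le (hgen : generatorGraph T = dirichletLaplacianGraph 𝕜) {α : ℝ} (hα : α < 1)
    {W : ℝ → ℝ} {N : ℝ} (hW : AEMeasurable W halfLine) (hN : ∀ x, |W x| ≤ N)
    (hWi : IntegrableOn (fun x => x * |W x|) (Ioi 0)) (hWα : ∫ x in Ioi (0 : ℝ), x * |W x| ≤ α)
    (hR : IsBoundedPerturbation T W R) {ε L : ℝ} (hε : 0 < ε) (hL : 0 < L) (t : ℝ≥0)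
    (f : HalfLineL2 𝕜) :
    ∫⁻ x in Ioi (0 : ℝ), ENNReal.ofReal (x * (L - x) / L * smoothNorm ε (R t f x))
      ≤ ENNReal.ofReal (1 - α)⁻¹ * (∫⁻ x in Ioi (0 : ℝ), ENNReal.ofReal x * ‖f x‖ₑ)
        + ENNReal.ofReal (ε * ((1 - α)⁻¹ * α) * t) := by
  obtain ⟨ω, C, hωm, hω, h⟩ :=
    exists_weightedSmoothNorm_perturbation_le hgen hα hW hN hWi hWα hR hε hL t
  have hβ : 0 ≤ (1 - α)⁻¹ := inv_nonneg.2 (sub_pos.2 hα).le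
  have hC := fun x hx => (hω x hx).2.1
  have h0 := fun x hx => (hω x hx).2.2.1
  calc ∫⁻ x in Ioi (0 : ℝ), ENNReal.ofReal (x * (L - x) / L * smoothNorm ε (R t f x))
      ≤ ∫⁻ x in Ioi (0 : ℝ), ENNReal.ofReal (ω x * smoothNorm ε (R t f x)) := by
        refine lintegral_mono_ae ((ae_restrict_mem measurableSet_Ioi).mono fun x hx => ?_)
        exact ENNReal.ofReal_le_ofReal
          (mul_le_mul_of_nonneg_right (hω x hx).1 (smoothNorm_nonneg _))
    _ = ENNReal.ofReal (weightedSmoothNorm ε ω (R t f)) :=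
        (ofReal_weightedSmoothNorm hε hωm hC h0 _).symm
    _ ≤ ENNReal.ofReal (weightedSmoothNorm ε ω f) + ENNReal.ofReal (ε * ((1 - α)⁻¹ * α) * t) :=
        (ENNReal.ofReal_le_ofReal (h f)).trans ENNReal.ofReal_add_le
    _ ≤ _ := by
        gcongr
        rw [ofReal_weightedSmoothNorm hε hωm hC h0, ← lintegral_const_mul' _ _ ENNReal.ofReal_ne_top]
        refine lintegral_mono_ae ((ae_restrict_mem measurableSet_Ioi).mono fun x hx => ?_)
        rw [← ofReal_norm, ← ENNReal.ofReal_mul (le_of_lt hx), ← ENNReal.ofReal_mul hβ,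
          ← mul_assoc]
        refine ENNReal.ofReal_le_ofReal ?_
        exact mul_le_mul (hω x hx).2.2.2 (smoothNorm_le_norm hε _) (smoothNorm_nonneg _)
          (mul_nonneg hβ (le_of_lt hx))

theorem tendsto_smoothNorm {H : Type*} [NormedAddCommGroup H] (z : H) {ε : ℕ → ℝ}
    (hε : Tendsto ε atTop (𝓝 0)) : Tendsto (fun n => smoothNorm (ε n) z) atTop (𝓝 ‖z‖) := by
  have h : Continuous fun ε : ℝ => smoothNorm ε z := by
    unfold smoothNorm
    fun_prop
  have h0 : smoothNorm 0 z = ‖z‖ := by simp [smoothNorm]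
  exact h0 ▸ (h.tendsto 0).comp hε

/-- The weighted `L₁`-estimate for the semigroup of a bounded potential. -/
theorem lintegral_perturbation_le (hgen : generatorGraph T = dirichletLaplacianGraph 𝕜) {α : ℝ} (hα : α < 1)
    {W : ℝ → ℝ} {N : ℝ} (hW : AEMeasurable W halfLine) (hN : ∀ x, |W x| ≤ N)
    (hWi : IntegrableOn (fun x => x * |W x|) (Ioi 0)) (hWα : ∫ x in Ioi (0 : ℝ), x * |W x| ≤ α)
    (hR : IsBoundedPerturbation T W R) (t : ℝ≥0) (f : HalfLineL2 𝕜) :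
    ∫⁻ x in Ioi (0 : ℝ), ENNReal.ofReal x * ‖R t f x‖ₑ
      ≤ ENNReal.ofReal (1 - α)⁻¹ * ∫⁻ x in Ioi (0 : ℝ), ENNReal.ofReal x * ‖f x‖ₑ := by
  -- Coupling `L = ε⁻¹` performs both limits at once: `x(L-x)/L = x(1 - εx) → x`.
  set ε : ℕ → ℝ := fun n => 1 / ((n : ℝ) + 1)
  have hε : ∀ n, 0 < ε n := fun n => Nat.one_div_pos_of_nat
  have hε0 : Tendsto ε atTop (𝓝 0) := tendsto_one_div_add_atTop_nhds_zero_nat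
  have hlim : ∀ x, 0 < x → Tendsto
      (fun n => ENNReal.ofReal (x * ((ε n)⁻¹ - x) / (ε n)⁻¹ * smoothNorm (ε n) (R t f x))) atTop
      (𝓝 (ENNReal.ofReal x * ‖R t f x‖ₑ)) := fun x hx => by
    rw [← ofReal_norm, ← ENNReal.ofReal_mul hx.le]
    refine ENNReal.tendsto_ofReal (Tendsto.mul ?_ (tendsto_smoothNorm _ hε0))
    have h : Tendsto (fun n => x * (1 - x * ε n)) atTop (𝓝 (x * (1 - x * 0))) :=
      ((hε0.const_mul x).const_sub 1).const_mul x
    rw [mul_zero, sub_zero, mul_one] at h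
    refine h.congr fun n => ?_
    have := (hε n).ne'
    field_simp
  have hrhs : Tendsto (fun n => ENNReal.ofReal (1 - α)⁻¹
        * (∫⁻ x in Ioi (0 : ℝ), ENNReal.ofReal x * ‖f x‖ₑ)
        + ENNReal.ofReal (ε n * ((1 - α)⁻¹ * α) * t)) atTop
      (𝓝 (ENNReal.ofReal (1 - α)⁻¹ * ∫⁻ x in Ioi (0 : ℝ), ENNReal.ofReal x * ‖f x‖ₑ)) := by
    have h : Tendsto (fun n => ENNReal.ofReal (ε n * ((1 - α)⁻¹ * α) * t)) atTop
        (𝓝 (ENNReal.ofReal (0 * ((1 - α)⁻¹ * α) * t))) :=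
      ENNReal.tendsto_ofReal ((hε0.mul_const _).mul_const _)
    rw [zero_mul, zero_mul, ENNReal.ofReal_zero] at h
    simpa using h.const_add (ENNReal.ofReal (1 - α)⁻¹
        * (∫⁻ x in Ioi (0 : ℝ), ENNReal.ofReal x * ‖f x‖ₑ))
  calc ∫⁻ x in Ioi (0 : ℝ), ENNReal.ofReal x * ‖R t f x‖ₑ
      = ∫⁻ x in Ioi (0 : ℝ), liminf (fun n => ENNReal.ofReal
          (x * ((ε n)⁻¹ - x) / (ε n)⁻¹ * smoothNorm (ε n) (R t f x))) atTop :=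
        setLIntegral_congr_fun measurableSet_Ioi fun x hx => (hlim x hx).liminf_eq.symm
    _ ≤ liminf (fun n => ∫⁻ x in Ioi (0 : ℝ), ENNReal.ofReal
          (x * ((ε n)⁻¹ - x) / (ε n)⁻¹ * smoothNorm (ε n) (R t f x))) atTop := by
        refine lintegral_liminf_le' fun n => ?_
        have h1 : Continuous fun x : ℝ => x * ((ε n)⁻¹ - x) / (ε n)⁻¹ := by fun_prop
        have h2 : AEMeasurable (fun x => smoothNorm (ε n) (R t f x)) halfLine :=
          ((contDiff_smoothNorm (hε n)).continuous.comp_aestronglyMeasurable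
            (Lp.aestronglyMeasurable (R t f))).aemeasurable
        exact (h1.aemeasurable.mul h2).ennreal_ofReal
    _ ≤ liminf (fun n => ENNReal.ofReal (1 - α)⁻¹
        * (∫⁻ x in Ioi (0 : ℝ), ENNReal.ofReal x * ‖f x‖ₑ)
        + ENNReal.ofReal (ε n * ((1 - α)⁻¹ * α) * t)) atTop :=
        liminf_le_liminf (Eventually.of_forall fun n =>
          lintegral_smoothNorm_perturbation_le hgen hα hW hN hWi hWα hR (hε n)
            (inv_pos.2 (hε n)) t f)
    _ = _ := hrhs.liminf_eq

end HalfLine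

/-- Weighted `L₁`-bounds are preserved under convergence in `L_p`. -/
theorem lintegral_mul_enorm_le_of_tendsto {𝕜 Ω : Type*} [RCLike 𝕜] [MeasurableSpace Ω]
    {μ : Measure Ω} {p : ℝ≥0∞} [Fact (1 ≤ p)] {f : ℕ → Lp 𝕜 p μ} {g : Lp 𝕜 p μ}
    (h : Tendsto f atTop (𝓝 g)) {ρ : Ω → ℝ≥0∞} (hρ : AEMeasurable ρ μ) (hρt : ∀ x, ρ x ≠ ∞)
    {C : ℝ≥0∞} (hC : ∀ n, ∫⁻ x, ρ x * ‖f n x‖ₑ ∂μ ≤ C) : ∫⁻ x, ρ x * ‖g x‖ₑ ∂μ ≤ C := by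
  -- Fatou's lemma along an almost everywhere convergent subsequence.
  obtain ⟨ns, -, hns⟩ := (tendstoInMeasure_of_tendsto_Lp h).exists_seq_tendsto_ae
  calc ∫⁻ x, ρ x * ‖g x‖ₑ ∂μ = ∫⁻ x, liminf (fun n => ρ x * ‖f (ns n) x‖ₑ) atTop ∂μ := by
        refine lintegral_congr_ae (hns.mono fun x hx => ?_)
        exact (ENNReal.Tendsto.const_mul ((continuous_enorm.tendsto _).comp hx)
          (Or.inr (hρt x))).liminf_eq.symm
    _ ≤ liminf (fun n => ∫⁻ x, ρ x * ‖f (ns n) x‖ₑ ∂μ) atTop :=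
        lintegral_liminf_le' fun n => hρ.mul (Lp.aestronglyMeasurable _).enorm
    _ ≤ C := liminf_le_of_le (by isBoundedDefault) fun b hb => by
        obtain ⟨n, hn⟩ := hb.exists
        exact hn.trans (hC _)

/-! ### Passage to the operator norm and to the limit semigroup -/

section HalfLine

variable {𝕜 : Type*} [RCLike 𝕜] {T S : ℝ≥0 → HalfLineL2 𝕜 →L[𝕜] HalfLineL2 𝕜}

theorem eLpNorm_one_withDensity_sq (f : ℝ → 𝕜) :
    eLpNorm f 1 (halfLine.withDensity fun x => ENNReal.ofReal (x ^ 2))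
      = ∫⁻ x in Ioi (0 : ℝ), ENNReal.ofReal (x ^ 2) * ‖f x‖ₑ := by
  rw [eLpNorm_one_eq_lintegral_enorm,
    lintegral_withDensity_eq_lintegral_mul_non_measurable _ (by fun_prop)
      (Eventually.of_forall fun x => ENNReal.ofReal_lt_top)]
  rfl

/-- Under `g = m f` the norms of `f` and `m⁻¹ A g` in `L₁(m²λ)` become `∫ x|g|` and `∫ x|A g|`. -/
theorem weightedOpNorm_id_sq_le {A : HalfLineL2 𝕜 →L[𝕜] HalfLineL2 𝕜} {c : ℝ≥0∞}
    (hA : ∀ g, ∫⁻ x in Ioi (0 : ℝ), ENNReal.ofReal x * ‖A g x‖ₑ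
      ≤ c * ∫⁻ x in Ioi (0 : ℝ), ENNReal.ofReal x * ‖g x‖ₑ) :
    weightedOpNorm A (fun x => x) (fun x => x ^ 2) 1 1 ≤ c := by
  refine iSup_le fun f => iSup_le fun _ => iSup_le fun hf => iSup_le fun h => ?_
  rw [eLpNorm_one_withDensity_sq] at hf ⊢
  have e1 : ∫⁻ x in Ioi (0 : ℝ), ENNReal.ofReal (x ^ 2) * ‖(x : 𝕜)⁻¹ * A (h.toLp _) x‖ₑ
      = ∫⁻ x in Ioi (0 : ℝ), ENNReal.ofReal x * ‖A (h.toLp _) x‖ₑ := by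
    refine setLIntegral_congr_fun measurableSet_Ioi fun x hx => ?_
    have hx0 : 0 < x := hx
    beta_reduce
    rw [← ofReal_norm, ← ofReal_norm, ← ENNReal.ofReal_mul (sq_nonneg _),
      ← ENNReal.ofReal_mul hx0.le, norm_mul, norm_inv, RCLike.norm_ofReal, abs_of_pos hx0]
    congr 1
    field_simp
  have e2 : ∫⁻ x in Ioi (0 : ℝ), ENNReal.ofReal x * ‖(h.toLp _ : HalfLineL2 𝕜) x‖ₑ
      = ∫⁻ x in Ioi (0 : ℝ), ENNReal.ofReal (x ^ 2) * ‖f x‖ₑ := by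
    refine lintegral_congr_ae ?_
    filter_upwards [h.coeFn_toLp, ae_restrict_mem measurableSet_Ioi] with x h1 hx
    have hx0 : 0 < x := hx
    rw [h1, ← ofReal_norm, ← ofReal_norm, ← ENNReal.ofReal_mul (sq_nonneg _),
      ← ENNReal.ofReal_mul hx0.le, norm_mul, RCLike.norm_ofReal, abs_of_pos hx0, sq, mul_assoc]
  rw [e1]
  refine (hA _).trans ?_
  rw [e2]
  exact (mul_le_mul_right hf c).trans_eq (mul_one c)

theorem lintegral_perturbedSemigroup_le (hgen : generatorGraph T = dirichletLaplacianGraph 𝕜) {V : ℝ → ℝ}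
    (hV : IntegrableOn (fun x => x * |V x|) (Ioi 0)) {α : ℝ}
    (hα : α < 1) (hVα : ∫ x in Ioi (0 : ℝ), x * |V x| ≤ α) {W : ℕ → ℝ → ℝ}
    (hW : ∀ n, AEMeasurable (W n) halfLine) (hWn : ∀ n x, |W n x| ≤ n)
    (hWV : ∀ n x, |W n x| ≤ |V x|) (hS : IsStrongLimitOfPerturbations T W S) (t : ℝ≥0)
    (g : HalfLineL2 𝕜) :
    ∫⁻ x in Ioi (0 : ℝ), ENNReal.ofReal x * ‖S t g x‖ₑ
      ≤ ENNReal.ofReal (1 - α)⁻¹ * ∫⁻ x in Ioi (0 : ℝ), ENNReal.ofReal x * ‖g x‖ₑ := by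
  obtain ⟨R, hR, hlim⟩ := hS
  refine lintegral_mul_enorm_le_of_tendsto (hlim t g) (by fun_prop)
    (fun x => ENNReal.ofReal_ne_top) fun n => ?_
  have hi : IntegrableOn (fun x => x * |W n x|) (Ioi 0) := by
    refine Integrable.mono hV
      (aemeasurable_id.mul (hW n).abs).aestronglyMeasurable (Eventually.of_forall fun x => ?_)
    simp only [norm_mul, Real.norm_eq_abs, abs_abs]
    exact mul_le_mul_of_nonneg_left (hWV n x) (abs_nonneg x)
  refine lintegral_perturbation_le hgen hα (hW n) (hWn n) hi ?_ (hR n) t g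
  refine (setIntegral_mono_on hi hV measurableSet_Ioi fun x hx => ?_).trans hVα
  exact mul_le_mul_of_nonneg_left (hWV n x) (le_of_lt hx)

end HalfLine

/-! ### Truncations of the potential: eventually constant at each point and dominated by `|V|` -/

theorem tendsto_max_min_natCast (v : ℝ) :
    Tendsto (fun n : ℕ => max (min v n) (-(n : ℝ))) atTop (𝓝 v) := by
  obtain ⟨N, hN⟩ := exists_nat_ge |v|
  refine tendsto_const_nhds.congr' ((eventually_ge_atTop N).mono fun n hn => ?_)
  have h : |v| ≤ n := hN.trans (Nat.cast_le.2 hn)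
  beta_reduce
  rw [min_eq_left (abs_le.1 h).2, max_eq_left (abs_le.1 h).1]

theorem tendsto_min_max_zero_natCast (v : ℝ) :
    Tendsto (fun n : ℕ => min (max v 0) (n : ℝ)) atTop (𝓝 (max v 0)) := by
  obtain ⟨N, hN⟩ := exists_nat_ge (max v 0)
  refine tendsto_const_nhds.congr' ((eventually_ge_atTop N).mono fun n hn => ?_)
  beta_reduce
  rw [min_eq_left (hN.trans (Nat.cast_le.2 hn))]

theorem tendsto_max_min_zero_natCast (v : ℝ) :
    Tendsto (fun n : ℕ => max (min v 0) (-(n : ℝ))) atTop (𝓝 (min v 0)) := by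
  obtain ⟨N, hN⟩ := exists_nat_ge (-min v 0)
  refine tendsto_const_nhds.congr' ((eventually_ge_atTop N).mono fun n hn => ?_)
  beta_reduce
  rw [max_eq_left (neg_le.1 (hN.trans (Nat.cast_le.2 hn)))]

theorem abs_max_min_le {v r : ℝ} (hr : 0 ≤ r) :
    |max (min v r) (-r)| ≤ r ∧ |max (min v r) (-r)| ≤ |v| := by
  rcases abs_cases v with h | h <;>
    rcases abs_cases (max (min v r) (-r)) with h' | h' <;>
      rcases max_cases (min v r) (-r) with h'' | h'' <;>
        rcases min_cases v r with h''' | h''' <;> constructor <;> linarith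

theorem abs_min_max_zero_le {v r : ℝ} (hr : 0 ≤ r) :
    |min (max v 0) r| ≤ r ∧ |min (max v 0) r| ≤ |v| := by
  rw [abs_of_nonneg (le_min (le_max_right _ _) hr)]
  exact ⟨min_le_right _ _, (min_le_left _ _).trans (max_le (le_abs_self v) (abs_nonneg v))⟩

theorem abs_max_min_zero_le {v r : ℝ} (hr : 0 ≤ r) :
    |max (min v 0) (-r)| ≤ r ∧ |max (min v 0) (-r)| ≤ |v| := by
  rw [abs_of_nonpos (max_le (min_le_right _ _) (neg_nonpos.2 hr))]
  exact ⟨neg_le.1 (le_max_right _ _), neg_le.1 ((le_min (neg_abs_le v)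
    (neg_nonpos.2 (abs_nonneg v))).trans (le_max_left _ _))⟩

end

theorem mainTheorem11 {𝕜 : Type*} [RCLike 𝕜]
    (T : ℝ≥0 → HalfLineL2 𝕜 →L[𝕜] HalfLineL2 𝕜)
    (hT : IsC0Semigroup T)
    (hgen : generatorGraph T = dirichletLaplacianGraph 𝕜)
    (V : ℝ → ℝ) (hV : AEMeasurable V halfLine)
    (α : ℝ) (hα0 : 0 < α) (hα1 : α < 1)
    (hint : ∫⁻ x in Ioi (0 : ℝ), ENNReal.ofReal (x * |V x|) ≤ ENNReal.ofReal α) :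
    IsAdmissible T V ∧
      (∃ S, IsPerturbedSemigroup T V S) ∧
      ∀ S, IsPerturbedSemigroup T V S →
        ∀ t : ℝ≥0,
          weightedOpNorm (S t) (fun x => x) (fun x => x ^ 2) 1 1 ≤
            ENNReal.ofReal (1 / (1 - α)) := by
  have hnn : 0 ≤ᵐ[halfLine] fun x => x * |V x| :=
    (ae_restrict_mem measurableSet_Ioi).mono fun x hx => mul_nonneg (le_of_lt hx) (abs_nonneg _)
  have hVi : IntegrableOn (fun x => x * |V x|) (Ioi 0) :=
    ⟨(aemeasurable_id.mul hV.abs).aestronglyMeasurable,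
      (hasFiniteIntegral_iff_ofReal hnn).2 (hint.trans_lt ENNReal.ofReal_lt_top)⟩
  have hVα : ∫ x in Ioi (0 : ℝ), x * |V x| ≤ α := by
    rw [← ENNReal.ofReal_le_ofReal_iff hα0.le, ofReal_integral_eq_lintegral_ofReal hVi hnn]
    exact hint
  have hn : ∀ n : ℕ, (0 : ℝ) ≤ n := fun n => n.cast_nonneg
  refine ⟨⟨?_, ?_⟩, ?_, fun S hS t => ?_⟩
  · exact exists_isStrongLimitOfPerturbations hT hgen hVi hα1 hVα
      (fun n => (hV.max aemeasurable_const).min aemeasurable_const)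
      (fun n x => (abs_min_max_zero_le (hn n)).1) (fun n x => (abs_min_max_zero_le (hn n)).2)
      fun x => tendsto_min_max_zero_natCast (V x)
  · exact exists_isStrongLimitOfPerturbations hT hgen hVi hα1 hVα
      (fun n => (hV.min aemeasurable_const).max aemeasurable_const)
      (fun n x => (abs_max_min_zero_le (hn n)).1) (fun n x => (abs_max_min_zero_le (hn n)).2)
      fun x => tendsto_max_min_zero_natCast (V x)
  · exact exists_isStrongLimitOfPerturbations hT hgen hVi hα1 hVα
      (fun n => (hV.min aemeasurable_const).max aemeasurable_const)
      (fun n x => (abs_max_min_le (hn n)).1) (fun n x => (abs_max_min_le (hn n)).2)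
      fun x => tendsto_max_min_natCast (V x)
  · rw [one_div]
    exact weightedOpNorm_id_sq_le fun g => lintegral_perturbedSemigroup_le hgen hVi hα1 hVα
      (fun n => (hV.min aemeasurable_const).max aemeasurable_const)
      (fun n x => (abs_max_min_le (hn n)).1) (fun n x => (abs_max_min_le (hn n)).2) hS.2 t g
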